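/- **Setting.** Let $\mathcal I$ be a finite or countable alphabet, $A$ a $0$-$1$ transition matrix, $\Sigma=\Sigma_A^{\mathcal I}$ the one-sided topological Markov chain with left shift $\sigma$ and distance $d(x,y)=2^{-\min\{n:\,x_n\ne y_n\}}$, assumed topologically mixing: for all $a,b\in\mathcal I$ and all large $n$ there is $x\in\Sigma$ with $x_0=a$, $x_n=b$. Write $C(n,x)=\{y\in\Sigma: y_k=x_k,\ 0\le k\le n\}$ ($n$-cylinder) and $S_n\phi=\sum_{k<n}\phi\circ\sigma^k$. A probability $\nu$ on $\Sigma$ is a *local weak Gibbs measure* for $\psi:\Sigma\to\mathbb R$ with constant $P$, sequence $1\le K_n\le K_{n+1}$, $\frac1n\log K_n\to0$, and local constants $c(i)\ge1$ ($i\in\mathcal I$), if all nonempty cylinders have positive measure and, for all $n\ge 1$ and $x\in\Sigma$, for $\nu$-a.e. $z\in C(n-1,x)$, $$\frac1{c(x_0)K_n}\le\frac{\nu(C(n-1,x))}{\exp(-nP+S_n\psi(z))}\le c(x_0)K_n ;$$ it is a local weak $\sigma$-Gibbs measure if it is also $\sigma$-invariant, and it is mixing if $\nu(B\cap\sigma^{-n}D)\to\nu(B)\nu(D)$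 for all Borel $B,D$. The Gurevich pressure $P_G(\psi)$ is the exponential growth rate of $Z_n(\psi,i)=\sum_{x_0=i,\ \sigma^nx=x}e^{S_n\psi(x)}$. Let $\phi:\Sigma\to\mathbb R$ satisfy $\sum_{n\ge1}V_n(\phi)<\infty$, where $V_n(\phi)=\sup\{|\phi(x)-\phi(y)|: x_k=y_k,\ 0\le k<n\}$, or let $\mathcal I$ be finite and $\phi$ continuous. Let $\widehat\mu$ be an atomless local weak $\sigma$-Gibbs measure for $\phi$, with sequence $K_n$ and local constants $c$. Let $w\in\Sigma$ be a $\widehat\mu$-hitting point: there are $p_1<p_2<\cdots$ with $\sup_jc(w_{p_j})<\infty$. Let $\ell_n\in\mathbb N$, with $\limsup_n\ell_n/n<\infty$ if $\sup_nK_n=\infty$, and assume $$\overline s=\limsup_{n\to\infty}\frac1n\log\frac1{\widehat\mu(C(\ell_n,w))}<\infty .$$ Let $\widehat P=C(N,u)$ be a cylinder and $W=\{z\in\widehat P:\sigma^k(z)\in C(\ell_k,w)\text{ for infinitely many }k\}$. For $E\subset\Sigma$, $\mathrm{Dim}_{\widehat\mu}(E)$ is the infimum of the $\alpha\ge0$ such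 that $\lim_{\varepsilon\to0}\inf\{\sum_i\widehat\mu(F_i)^\alpha: E\subset\bigcup_iF_i,\ F_i\text{ cylinders},\ \mathrm{diam}\,F_i\le\varepsilon\}=0$ (countable covers). A *pattern* consists of sets $\widetilde{\mathcal J}_j$ of $\widetilde d_j$-cylinders and $\mathcal J_j$ of $d_j$-cylinders ($j\ge0$), with $\widetilde{\mathcal J}_0=\mathcal J_0=\{J_0\}$, $\widetilde d_0=d_0$, and, for $j\ge1$, $d_{j-1}<\widetilde d_j\le d_j$, every element of $\mathcal J_j$ contained in one of $\widetilde{\mathcal J}_j$, every element of $\widetilde{\mathcal J}_j$ contained in one of $\mathcal J_{j-1}$, and every $\widetilde J_j\in\widetilde{\mathcal J}_j$ containing exactly one $J_j\in\mathcal J_j$. Its pattern set is $\mathcal Z=\bigcap_j\bigcup_{J\in\mathcal J_j}J$. For $t>0$, call $\widehat{\mathbf m}$ *admissible for $t$* if it is a mixing local weak $\sigma$-Gibbs measure for $t\phi$ whose local constants satisfy $\sup_jc_{\widehat{\mathbf m}}(w_{p_j})<\infty$, and $\phi\in L^1(\widehat{\mathbf m})$. **Theorem.** There is a sequence $1\le\widehat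 s_m\le\widehat s_{m+1}$ with $\frac1m\log\widehat s_m\to0$, constant if $\sup_nK_n<\infty$, such that for all $z\in \Sigma$ with $z_0=u_0$ and all $n,j$ with $z_n=w_{p_j}$, $$\frac1{\widehat s_m}\frac{\widehat\mu(\sigma^nC(m,z))}{\widehat\mu(\sigma^nC(n,z))}\le\frac{\widehat\mu(C(m,z))}{\widehat\mu(C(n,z))}\le\widehat s_m\frac{\widehat\mu(\sigma^nC(m,z))}{\widehat\mu(\sigma^nC(n,z))}\quad(m>n),$$ $$\frac1{\widehat s_{n-1}}\frac1{\widehat\mu(\sigma^nC(n,z))}\le\frac{\widehat\mu(C(n-1,z))}{\widehat\mu(C(n,z))}\le\widehat s_{n-1}\frac1{\widehat\mu(\sigma^nC(n,z))}\quad(n\ge1),$$ and such that the following holds. Let $t,\varepsilon>0$ satisfy $$\infty>P_G(t\phi)-tP_G(\phi)\ge t\,\overline s+\varepsilon ,$$ and let $\widehat{\mathbf m}$ be admissible for $t$. Then there are a pattern with $J_0\subset\widehat P$ and constants $0<\overline\delta\le1$, $C>0$, such that, with $\gamma_j=\widetilde d_j(\overline s+\varepsilon/(2t))$: * $\mathcal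 Z\subset\{z\in J_0:\sigma^{\widetilde d_j}(z)\in C(\ell_{\widetilde d_j},w)\text{ for all }j\ge1\}\subset W$, and $\sup\{c(z_{d_j}):z\in\mathcal Z,\ j\ge0\}<\infty$; * (i) $\widehat\mu(\sigma^{d_{j-1}}J_j)/\widehat\mu(\sigma^{d_{j-1}}\widetilde J_j)\ge e^{-\gamma_j}$ for all $j\ge1$ and all $J_j\subset\widetilde J_j$ with $J_j\in\mathcal J_j$, $\widetilde J_j\in\widetilde{\mathcal J}_j$; * (ii) $\sum_{\widetilde J_j\in\widetilde{\mathcal J}_j,\ \widetilde J_j\subset J_{j-1}}\widehat{\mathbf m}(\sigma^{d_{j-1}}\widetilde J_j)\ge\overline\delta\,\widehat{\mathbf m}(\sigma^{d_{j-1}}J_{j-1})$ for all $j\ge1$ and all $J_{j-1}\in\mathcal J_{j-1}$; * (iii) for all $j\ge1$, $J_{j-1}\in\mathcal J_{j-1}$ and $C(m,z)\subset J_{j-1}$ with $d_{j-1}\le m\le\widetilde d_j$, $$\frac{\widehat{\mathbf m}(\sigma^{d_{j-1}}C(m,z))}{\widehat{\mathbf m}(\sigma^{d_{j-1}}J_{j-1})}\le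 C\,\overline\delta\left(\eta_m\frac{\widehat\mu(\sigma^{d_{j-1}}C(m,z))}{\widehat\mu(\sigma^{d_{j-1}}J_{j-1})}\right)^t,\qquad \eta_m=\begin{cases}\widehat s_{d_{j-1}}/\widehat s_m,&d_{j-1}\le m<\widetilde d_j,\\ e^{-\gamma_j}/\widehat s_{d_j}^{\,2},&m=\widetilde d_j;\end{cases}$$ * $\mathrm{Dim}_{\widehat\mu}(\mathcal Z)\ge t$. Consequently $\mathrm{Dim}_{\widehat\mu}(W)\ge T^-$, where $T^-$ is the supremum (equal to $0$ for the empty set) of the $t\in(0,1]$ such that $\infty>P_G(t\phi)-tP_G(\phi)>\overline s\,t$ and some $\widehat{\mathbf m}$ is admissible for $t$. -/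

import Mathlib

open MeasureTheory Filter Set
open scoped Topology ENNReal NNReal

/-- The one-sided topological Markov chain of the transition relation `A` on the alphabet `I`:
the infinite words all of whose transitions are allowed (`A a b` means `a_{a,b} = 1`). -/
def MarkovShift {I : Type*} (A : I → I → Prop) : Type _ :=
  {x : ℕ → I // ∀ k, A (x k) (x (k + 1))}

namespace MarkovShift

variable {I : Type*} {A : I → I → Prop}

instance : CoeFun (MarkovShift A) (fun _ => ℕ → I) := ⟨fun x => x.1⟩

/-- The distance is `2⁻ᵐ`, with `m` the first index at which two words differ. -/
noncomputable instance : MetricSpace (MarkovShift A) :=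
  letI : TopologicalSpace I := ⊥
  haveI : DiscreteTopology I := ⟨rfl⟩
  MetricSpace.induced (Subtype.val : MarkovShift A → (ℕ → I)) Subtype.val_injective
    (PiNat.metricSpace (E := fun _ => I))

noncomputable instance : MeasurableSpace (MarkovShift A) := borel _

instance : BorelSpace (MarkovShift A) := ⟨rfl⟩

/-- The left shift. -/
def shift (x : MarkovShift A) : MarkovShift A := ⟨fun k => x.1 (k + 1), fun k => x.2 (k + 1)⟩

/-- The `n`-cylinder `C(n, x)`: the words that agree with `x` in the places `0, …, n`. -/
def cyl (n : ℕ) (x : MarkovShift A) : Set (MarkovShift A) := {y | ∀ k ≤ n, y k = x k}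

/-- `J` is a (nonempty) `n`-cylinder. -/
def IsCyl (n : ℕ) (J : Set (MarkovShift A)) : Prop := ∃ x : MarkovShift A, J = cyl n x

/-- The family of all cylinders. -/
def cylinders (A : I → I → Prop) : Set (Set (MarkovShift A)) := {J | ∃ n, IsCyl n J}

/-- Topological mixing of the Markov chain. -/
def TopMixing (A : I → I → Prop) : Prop :=
  ∀ a b : I, ∃ N : ℕ, ∀ n ≥ N, ∃ x : MarkovShift A, x 0 = a ∧ x n = b

/-- The variation `V_n(φ)`, with values in `[0, ∞]`. -/
noncomputable def variation (φ : MarkovShift A → ℝ) (n : ℕ) : ℝ≥0∞ :=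
  ⨆ (x : MarkovShift A) (y : MarkovShift A) (_ : ∀ k < n, x k = y k), ENNReal.ofReal |φ x - φ y|

/-- `∑_{n ≥ 1} V_n(φ) < ∞`, that is, `φ` has summable variations and `V_1(φ) < ∞`. -/
def SummableVariations (φ : MarkovShift A → ℝ) : Prop := ∑' n : ℕ, variation φ (n + 1) < ⊤

/-- `Z_n(φ, i)`: the sum of `exp (S_n φ (x))` over the points `x` with `x_0 = i`, `σⁿ x = x`. -/
noncomputable def periodicSum (φ : MarkovShift A → ℝ) (i : I) (n : ℕ) : ℝ≥0∞ :=
  ∑' x : {x : MarkovShift A // x 0 = i ∧ shift^[n] x = x},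
    ENNReal.ofReal (Real.exp (birkhoffSum shift φ n x.1))

/-- The Gurevich pressure: the exponential growth rate of `Z_n(φ, i)`, which does not depend on the
symbol `i` for the potentials in question. -/
noncomputable def gurevichPressure (φ : MarkovShift A → ℝ) : EReal :=
  ⨆ i : I, limsup (fun n : ℕ => ENNReal.log (periodicSum φ i n) / (n : EReal)) atTop

/-- `P_G(tφ) - t P_G(φ)`. -/
noncomputable def pressureGap (φ : MarkovShift A → ℝ) (t : ℝ) : EReal :=
  gurevichPressure (fun x => t * φ x) - (t : EReal) * gurevichPressure φ

/-- `μ` is a local weak Gibbs measure for `φ`, with the constant `P`, the sequence `K` and the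
local constants `c`. Nonempty cylinders have positive measure. The `n`-cylinder
`cyl n x` is given by a word of length `n + 1`. -/
structure IsLocalWeakGibbs (μ : Measure (MarkovShift A)) (φ : MarkovShift A → ℝ)
    (P : ℝ) (K : ℕ → ℝ) (c : I → ℝ) : Prop where
  prob : IsProbabilityMeasure μ
  one_le_K : ∀ n, 1 ≤ K n
  mono_K : Monotone K
  subexp_K : Tendsto (fun n : ℕ => 1 / (n : ℝ) * Real.log (K n)) atTop (𝓝 0)
  one_le_c : ∀ i, 1 ≤ c i
  pos : ∀ (n : ℕ) (x : MarkovShift A), 0 < μ (cyl n x)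
  gibbs : ∀ (n : ℕ) (x : MarkovShift A), ∀ᵐ z ∂μ, z ∈ cyl n x →
    1 / (c (x 0) * K (n + 1)) ≤
        μ.real (cyl n x) / Real.exp (-((n + 1 : ℕ) : ℝ) * P + birkhoffSum shift φ (n + 1) z) ∧
      μ.real (cyl n x) / Real.exp (-((n + 1 : ℕ) : ℝ) * P + birkhoffSum shift φ (n + 1) z) ≤
        c (x 0) * K (n + 1)

/-- Mixing of the shift with respect to `m`. -/
def IsMixing (m : Measure (MarkovShift A)) : Prop :=
  ∀ B C : Set (MarkovShift A), MeasurableSet B → MeasurableSet C →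
    Tendsto (fun n : ℕ => m (B ∩ (shift^[n]) ⁻¹' C)) atTop (𝓝 (m B * m C))

/-- The constants `c` are bounded along the symbols `w_{p_j}`. -/
def BoundedAlong (c : I → ℝ) (w : MarkovShift A) (p : ℕ → ℕ) : Prop :=
  BddAbove (range fun j => c (w (p j)))

/-- `m` is a mixing local weak `σ`-Gibbs measure for `tφ`, with local constants bounded along
`w_{p_j}`, and `φ ∈ L¹(m)`. -/
def IsAuxMeasure (φ : MarkovShift A → ℝ) (w : MarkovShift A) (p : ℕ → ℕ) (t : ℝ)
    (m : Measure (MarkovShift A)) : Prop :=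
  (∃ (P : ℝ) (K : ℕ → ℝ) (c : I → ℝ),
    IsLocalWeakGibbs m (fun x => t * φ x) P K c ∧ BoundedAlong c w p) ∧
  MeasurePreserving shift m m ∧ IsMixing m ∧ Integrable φ m

/-- The target-ball set: the points `z` of `Q` with `σᵏ z ∈ C(ℓ_k, w)` for infinitely many `k`. -/
def targetSet (Q : Set (MarkovShift A)) (l : ℕ → ℕ) (w : MarkovShift A) : Set (MarkovShift A) :=
  {z | z ∈ Q ∧ ∃ᶠ k in atTop, shift^[k] z ∈ cyl (l k) w}

/-- `μ(σⁿ U) / μ(σⁿ V)`. -/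
noncomputable def shiftRatio (μ : Measure (MarkovShift A)) (n : ℕ)
    (U V : Set (MarkovShift A)) : ℝ :=
  μ.real (shift^[n] '' U) / μ.real (shift^[n] '' V)

/-- `s` is a nondecreasing subexponential sequence `≥ 1` which controls the distortion of `μ` under
`σⁿ` on the cylinders `C(n, z)` that start with the symbol `a` and end with some symbol
`w_{p_j}`, that is, `σⁿ(C(n, z)) = C(0, σ^{p_j} w)`. -/
structure IsDistortionSeq (μ : Measure (MarkovShift A)) (a : I) (w : MarkovShift A) (p : ℕ → ℕ)
    (s : ℕ → ℝ) : Prop where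
  one_le : ∀ m, 1 ≤ s m
  mono : Monotone s
  subexp : Tendsto (fun m : ℕ => 1 / (m : ℝ) * Real.log (s m)) atTop (𝓝 0)
  compare : ∀ (z : MarkovShift A) (n j : ℕ), z 0 = a → z n = w (p j) → ∀ m > n,
    1 / s m * shiftRatio μ n (cyl m z) (cyl n z) ≤ μ.real (cyl m z) / μ.real (cyl n z) ∧
      μ.real (cyl m z) / μ.real (cyl n z) ≤ s m * shiftRatio μ n (cyl m z) (cyl n z)
  compare_pred : ∀ (z : MarkovShift A) (n j : ℕ), z 0 = a → z (n + 1) = w (p j) →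
    1 / s n * (1 / μ.real (shift^[n + 1] '' cyl (n + 1) z)) ≤
        μ.real (cyl n z) / μ.real (cyl (n + 1) z) ∧
      μ.real (cyl n z) / μ.real (cyl (n + 1) z) ≤
        s n * (1 / μ.real (shift^[n + 1] '' cyl (n + 1) z))

/-- The families `Jt j` of `dt j`-cylinders and `J j` of `d j`-cylinders form a pattern with first
element `J0`. -/
structure IsPattern (dt d : ℕ → ℕ) (Jt J : ℕ → Set (Set (MarkovShift A)))
    (J0 : Set (MarkovShift A)) : Prop where
  isCyl_tilde : ∀ j, ∀ U ∈ Jt j, IsCyl (dt j) U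
  isCyl : ∀ j, ∀ U ∈ J j, IsCyl (d j) U
  zero_tilde : Jt 0 = {J0}
  zero : J 0 = {J0}
  depth_zero : dt 0 = d 0
  lt : ∀ j, d j < dt (j + 1)
  le : ∀ j, dt (j + 1) ≤ d (j + 1)
  finer : ∀ j, ∀ U ∈ J (j + 1), ∃ V ∈ Jt (j + 1), U ⊆ V
  finer_tilde : ∀ j, ∀ V ∈ Jt (j + 1), ∃ U ∈ J j, V ⊆ U
  unique : ∀ j, ∀ V ∈ Jt j, ∃! U, U ∈ J j ∧ U ⊆ V

/-- The set with pattern `(Jt, J)`; it is determined by `J`. -/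
def patternSet (J : ℕ → Set (Set (MarkovShift A))) : Set (MarkovShift A) := ⋂ j, ⋃₀ J j

/-- The estimates satisfied by a pattern, for the measures `μ` and `m`, the exponent `t`, the
numbers `γ j`, the distortion sequence `s` and the constants `δ` and `C`. -/
structure PatternEstimates (μ m : Measure (MarkovShift A)) (t : ℝ) (γ : ℕ → ℝ) (s : ℕ → ℝ)
    (δ C : ℝ) (dt d : ℕ → ℕ) (Jt J : ℕ → Set (Set (MarkovShift A))) : Prop where
  lower : ∀ j, ∀ V ∈ Jt (j + 1), ∀ U ∈ J (j + 1), U ⊆ V →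
    Real.exp (-γ (j + 1)) ≤ shiftRatio μ (d j) U V
  mass : ∀ j, ∀ U ∈ J j,
    ENNReal.ofReal δ * m (shift^[d j] '' U) ≤
      ∑' V : {V : Set (MarkovShift A) // V ∈ Jt (j + 1) ∧ V ⊆ U}, m (shift^[d j] '' V.1)
  upper : ∀ j, ∀ U ∈ J j, ∀ (z : MarkovShift A) (n : ℕ), d j ≤ n → n < dt (j + 1) →
    cyl n z ⊆ U →
      shiftRatio m (d j) (cyl n z) U ≤
        C * δ * (s (d j) / s n * shiftRatio μ (d j) (cyl n z) U) ^ t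
  upper_last : ∀ j, ∀ U ∈ J j, ∀ z : MarkovShift A, cyl (dt (j + 1)) z ⊆ U →
    shiftRatio m (d j) (cyl (dt (j + 1)) z) U ≤
      C * δ * (Real.exp (-γ (j + 1)) / s (d (j + 1)) ^ 2 *
        shiftRatio μ (d j) (cyl (dt (j + 1)) z) U) ^ t

end MarkovShift

/-- Carathéodory's construction from the family `F` and the set function `ψ`. -/
noncomputable def caratheodoryMeasure {X : Type*} [MetricSpace X] (F : Set (Set X))
    (ψ : Set X → ℝ≥0∞) (E : Set X) : ℝ≥0∞ :=
  ⨆ (ε : ℝ≥0∞) (_ : 0 < ε),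
    ⨅ (U : Set (Set X)) (_ : U.Countable ∧ U ⊆ F ∧ E ⊆ ⋃₀ U ∧ ∀ B ∈ U, Metric.ediam B ≤ ε),
      ∑' B : U, ψ B.1

/-- The `(F, ψ)`-dimension: the infimum of the `α ≥ 0` for which Carathéodory's measure built from
`ψ ^ α` vanishes on `E`. -/
noncomputable def caratheodoryDim {X : Type*} [MetricSpace X] (F : Set (Set X))
    (ψ : Set X → ℝ≥0∞) (E : Set X) : ℝ≥0∞ :=
  ⨅ (α : ℝ≥0) (_ : caratheodoryMeasure F (fun B => ψ B ^ (α : ℝ)) E = 0), (α : ℝ≥0∞)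

/-- The `μ`-dimension of a subset of the Markov chain. -/
noncomputable def MarkovShift.dimMu {I : Type*} {A : I → I → Prop} (μ : Measure (MarkovShift A))
    (E : Set (MarkovShift A)) : ℝ≥0∞ :=
  caratheodoryDim (MarkovShift.cylinders A) (fun B => μ B) E

/-! Write μ and m for the Gibbs measures of φ and tφ, with Gibbs constants P and P'. Eliminating the
Birkhoff sum between the two Gibbs inequalities shows that the conditional m-mass of a cylinder r
letters deeper is at most the t-th power of its conditional μ-mass, times exp(-r(P' - tP)), up to
subexponential factors (`log_ratio_le`). Moreover P' ≥ P_G(tφ), because cylinders of periodic points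
are disjoint, and P ≤ P_G(φ), by recurrence; so the pressure hypothesis gives P' - tP ≥ t·sbar + ε.

The pattern follows orbits that reach w_0 at sparse times dt_j and then copy w up to an index p_i ≥
ℓ_{dt_j}. Mixing of m makes the conditional m-mass of the returns to w_0 at least δ = m([w_0])/2.
Copying w costs a μ-factor of about exp(-dt_j·sbar). Since the gain t·sbar + ε per letter exceeds
this cost raised to the power t, the surplus ε pays for all constants and subexponential errors once
dt_j is large; in particular the estimate at depth dt_j holds with no constant C, so nothing
accumulates from level to level (`exists_next_visit`, `exists_pattern`).

For the dimension bound, give U in J_j the weight (μ(U)/s_{d_j})^t. The estimates say that the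
children of U can share its weight in proportion to m-mass without exceeding their own weights, and
that the shares inside an intermediate cylinder F total at most C·μ(F)^t. If a cover by cylinders
had total t-mass below 1/C times the weight of J0, a double count (`exists_uncovered_child`) would
produce a child with the same deficit, and iteration an uncovered point of the pattern set
(`le_dimMu_patternSet`). No limit measure and no compactness are needed, so a countable alphabet
causes no difficulty. -/

namespace MarkovShift

variable {I : Type*} {A : I → I → Prop}

/-! ### Cylinders, the shift and continuity. -/

theorem shift_iterate_apply (n : ℕ) (x : MarkovShift A) (k : ℕ) :
    (shift^[n] x) k = x (n + k) := by
  induction n generalizing x with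
  | zero => simp
  | succ n ih =>
    rw [Function.iterate_succ_apply, ih]
    change x.1 (n + k + 1) = x.1 (n + 1 + k)
    exact congrArg x.1 (by omega)

theorem mem_cyl_self (n : ℕ) (x : MarkovShift A) : x ∈ cyl n x := fun _ _ => rfl

theorem cyl_eq_of_mem {n : ℕ} {x y : MarkovShift A} (h : y ∈ cyl n x) : cyl n y = cyl n x := by
  ext z
  exact ⟨fun hz k hk => (hz k hk).trans (h k hk), fun hz k hk => (hz k hk).trans (h k hk).symm⟩

theorem cyl_anti {m n : ℕ} (h : m ≤ n) (x : MarkovShift A) : cyl n x ⊆ cyl m x :=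
  fun _ hy k hk => hy k (hk.trans h)

/-- Two cylinders that meet are nested. -/
theorem cyl_subset_of_mem {m n : ℕ} (h : m ≤ n) {x y z : MarkovShift A} (hx : z ∈ cyl n x)
    (hy : z ∈ cyl m y) : cyl n x ⊆ cyl m y := by
  rw [← cyl_eq_of_mem hx, ← cyl_eq_of_mem hy]
  exact cyl_anti h z

theorem isOpen_cyl (n : ℕ) (x : MarkovShift A) : IsOpen (cyl n x) := by
  let : TopologicalSpace I := ⊥
  have : DiscreteTopology I := ⟨rfl⟩
  refine isOpen_induced_iff.2 ⟨PiNat.cylinder x.1 (n + 1), PiNat.isOpen_cylinder _ _ _, ?_⟩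
  ext y
  exact ⟨fun hy k hk => hy k (Nat.lt_succ_of_le hk), fun hy k hk => hy k (Nat.le_of_lt_succ hk)⟩

theorem measurableSet_cyl (n : ℕ) (x : MarkovShift A) : MeasurableSet (cyl n x) :=
  (isOpen_cyl n x).measurableSet

theorem exists_cyl_subset {s : Set (MarkovShift A)} {x : MarkovShift A} (hs : s ∈ 𝓝 x) :
    ∃ n, cyl n x ⊆ s := by
  let : TopologicalSpace I := ⊥
  have : DiscreteTopology I := ⟨rfl⟩
  obtain ⟨u, hu, hus⟩ := mem_nhds_induced (Subtype.val : MarkovShift A → ℕ → I) x s |>.1 hs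
  obtain ⟨v, ⟨y, n, rfl⟩, hxv, hvu⟩ :=
    (PiNat.isTopologicalBasis_cylinders (fun _ => I)).mem_nhds_iff.1 hu
  refine ⟨n, fun z hz => hus (hvu ?_)⟩
  rw [PiNat.mem_cylinder_iff] at hxv ⊢
  exact fun i hi => (hz i hi.le).trans (hxv i hi)

theorem shift_image_cyl {m n : ℕ} (h : n ≤ m) (x : MarkovShift A) :
    shift^[n] '' cyl m x = cyl (m - n) (shift^[n] x) := by
  ext y
  constructor
  · rintro ⟨z, hz, rfl⟩ k hk
    rw [shift_iterate_apply, shift_iterate_apply]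
    exact hz _ (by omega)
  · intro hy
    have hy' : ∀ k ≤ m - n, y k = x (n + k) := fun k hk => by
      rw [hy k hk, shift_iterate_apply]
    refine ⟨⟨fun k => if k < n then x k else y (k - n), fun k => ?_⟩, fun k hk => ?_, ?_⟩
    · by_cases h1 : k + 1 < n
      · simpa [h1, (Nat.lt_succ_self k).trans h1] using x.2 k
      · by_cases h2 : k < n
        · have : k + 1 - n = 0 := by omega
          have h3 : n + 0 = k + 1 := by omega
          simp only [h1, h2, if_true, if_false, this, hy' 0 (Nat.zero_le _), h3]
          exact x.2 k
        · have : k + 1 - n = k - n + 1 := by omega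
          simp only [h1, h2, if_false, this]
          exact y.2 _
    · change (if k < n then x k else y (k - n)) = x k
      split_ifs with h1
      · rfl
      · rw [hy' _ (by omega)]; exact congrArg x.1 (by omega)
    · apply Subtype.ext; funext k
      refine (shift_iterate_apply n _ k).trans ?_
      change (if n + k < n then x (n + k) else y (n + k - n)) = y k
      rw [if_neg (by omega), Nat.add_sub_cancel_left]

/-- The first `n + 1` letters of `x` followed by the letters `1, 2, …` of `y`. -/
theorem exists_splice {n : ℕ} {x y : MarkovShift A} (h : x n = y 0) :
    ∃ z ∈ cyl n x, shift^[n] z = y := by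
  have : y ∈ shift^[n] '' cyl n x := by
    rw [shift_image_cyl le_rfl, Nat.sub_self]
    intro k hk
    obtain rfl : k = 0 := by omega
    rw [shift_iterate_apply, Nat.add_zero, h]
  exact this

theorem countable_cylinders [Countable I] : (cylinders A).Countable := by
  refine (countable_range (fun q : Σ n : ℕ, (Fin (n + 1) → I) =>
    {y : MarkovShift A | ∀ k : Fin (q.1 + 1), y k = q.2 k})).mono ?_
  rintro _ ⟨n, x, rfl⟩
  refine ⟨⟨n, fun k => x k⟩, ?_⟩
  ext y
  exact ⟨fun hy k hk => hy ⟨k, Nat.lt_succ_of_le hk⟩, fun hy k => hy k (Nat.le_of_lt_succ k.2)⟩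

theorem SummableVariations.continuous {φ : MarkovShift A → ℝ} (h : SummableVariations φ) :
    Continuous φ := by
  have h0 : Tendsto (fun n => variation φ (n + 1)) atTop (𝓝 0) :=
    ENNReal.tendsto_atTop_zero_of_tsum_ne_top h.ne
  refine continuous_iff_continuousAt.2 fun x => Metric.tendsto_nhds.2 fun ε hε => ?_
  obtain ⟨n, hn⟩ := (h0.eventually (gt_mem_nhds (ENNReal.ofReal_pos.2 hε))).exists
  filter_upwards [(isOpen_cyl n x).mem_nhds (mem_cyl_self n x)] with y hy
  rw [Real.dist_eq]
  refine (ENNReal.ofReal_lt_ofReal_iff hε).1 (lt_of_le_of_lt ?_ hn)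
  exact le_iSup_of_le y (le_iSup_of_le x (le_iSup_of_le
    (fun k hk => hy k (Nat.le_of_lt_succ hk)) le_rfl))

theorem continuous_shift : Continuous (shift : MarkovShift A → MarkovShift A) := by
  refine continuous_iff_continuousAt.2 fun x s hs => ?_
  obtain ⟨n, hn⟩ := exists_cyl_subset hs
  refine mem_map.2 (mem_of_superset ((isOpen_cyl (n + 1) x).mem_nhds (mem_cyl_self _ x)) ?_)
  intro y hy
  exact hn fun k hk => hy (k + 1) (by omega)

theorem continuous_birkhoffSum {φ : MarkovShift A → ℝ} (h : Continuous φ) (n : ℕ) :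
    Continuous (birkhoffSum shift φ n) := by
  unfold birkhoffSum
  exact continuous_finsetSum _ fun k _ => h.comp (continuous_shift.iterate k)

namespace IsLocalWeakGibbs

variable {μ : Measure (MarkovShift A)} {φ : MarkovShift A → ℝ} {P : ℝ} {K : ℕ → ℝ} {c : I → ℝ}

theorem real_pos (h : IsLocalWeakGibbs μ φ P K c) (n : ℕ) (x : MarkovShift A) :
    0 < μ.real (cyl n x) :=
  haveI := h.prob
  ENNReal.toReal_pos (h.pos n x).ne' (measure_ne_top _ _)

/-- For a continuous potential the Gibbs inequality holds at every point. -/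
theorem abs_log_sub_le (h : IsLocalWeakGibbs μ φ P K c) (hφ : Continuous φ) (n : ℕ)
    (x : MarkovShift A) :
    |Real.log (μ.real (cyl n x)) - (-((n + 1 : ℕ) : ℝ) * P + birkhoffSum shift φ (n + 1) x)| ≤
      Real.log (c (x 0)) + Real.log (K (n + 1)) := by
  have hc := h.one_le_c (x 0)
  have hK := h.one_le_K (n + 1)
  set F : MarkovShift A → ℝ := fun z =>
    |Real.log (μ.real (cyl n x)) - (-((n + 1 : ℕ) : ℝ) * P + birkhoffSum shift φ (n + 1) z)|
    with hF
  have hFc : Continuous F := by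
    have := continuous_birkhoffSum hφ (n + 1)
    fun_prop
  by_contra! hlt
  -- A strict violation at `x` persists on a smaller cylinder; that cylinder has positive mass, so
  -- it contains a point where the almost sure inequality holds.
  obtain ⟨m, hm⟩ := exists_cyl_subset (hFc.continuousAt.preimage_mem_nhds (Ioi_mem_nhds hlt))
  have hpos := h.pos (max m n) x
  obtain ⟨z, hz, hz'⟩ : ∃ z ∈ cyl (max m n) x, (z ∈ cyl n x → _) :=
    (((frequently_ae_mem_iff).2 hpos.ne').and_eventually (h.gibbs n x)).exists
  obtain ⟨h1, h2⟩ := hz' (cyl_anti (le_max_right _ _) _ hz)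
  have h3 : _ < F z := hm (cyl_anti (le_max_left _ _) _ hz)
  have hμ := h.real_pos n x
  refine absurd h3 (not_lt.2 ?_)
  have hcK : 0 < c (x 0) * K (n + 1) := by positivity
  have e1 := Real.log_le_log (by positivity) h1
  have e2 := Real.log_le_log (by positivity) h2
  rw [Real.log_div one_ne_zero hcK.ne', Real.log_div hμ.ne' (Real.exp_pos _).ne', Real.log_exp,
    Real.log_mul (by positivity) (by positivity), Real.log_one] at e1
  rw [Real.log_div hμ.ne' (Real.exp_pos _).ne', Real.log_exp,
    Real.log_mul (by positivity) (by positivity)] at e2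
  exact abs_le.2 ⟨by linarith, by linarith⟩

end IsLocalWeakGibbs

end MarkovShift

/-! ### Periodic points, the Gibbs constant and the Gurevich pressure. -/

namespace MarkovShift

variable {I : Type*} {A : I → I → Prop}

theorem eq_of_periodic_of_mem_cyl {n : ℕ} {x y : MarkovShift A} (hx : shift^[n + 1] x = x)
    (hy : shift^[n + 1] y = y) (h : y ∈ cyl n x) : y = x := by
  have key : ∀ k, y k = x k := by
    intro k
    induction k using Nat.strong_induction_on with
    | _ k ih =>
      by_cases hk : k ≤ n
      · exact h k hk
      · have h1 := shift_iterate_apply (n + 1) x (k - (n + 1))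
        have h2 := shift_iterate_apply (n + 1) y (k - (n + 1))
        rw [hx] at h1
        rw [hy] at h2
        have e : n + 1 + (k - (n + 1)) = k := by omega
        rw [e] at h1 h2
        rw [← h1, ← h2]
        exact ih _ (by omega)
  exact Subtype.ext (funext key)

theorem exists_periodic_mem_cyl {n : ℕ} {y : MarkovShift A} (h : y (n + 1) = y 0) :
    ∃ x : MarkovShift A, x 0 = y 0 ∧ shift^[n + 1] x = x ∧ y ∈ cyl n x := by
  refine ⟨⟨fun k => y (k % (n + 1)), fun k => ?_⟩, ?_, ?_, ?_⟩
  · have h1 := y.2 (k % (n + 1))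
    have h2 := Nat.mod_lt k n.succ_pos
    by_cases h3 : k % (n + 1) = n
    · have : (k + 1) % (n + 1) = 0 := by
        rw [Nat.add_mod, h3]
        rcases n with _ | n
        · simp
        · rw [Nat.mod_eq_of_lt (a := 1) (by omega), Nat.mod_self]
      rw [h3] at h1
      simp only [this, h3]
      rw [show y.1 0 = y.1 (n + 1) from h.symm]
      exact h1
    · have : (k + 1) % (n + 1) = k % (n + 1) + 1 := by
        rw [Nat.add_mod]
        rcases n with _ | n
        · omega
        · have h4 : k % (n + 1 + 1) < n + 1 + 1 := Nat.mod_lt _ (by omega)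
          rw [Nat.mod_eq_of_lt (a := 1) (by omega), Nat.mod_eq_of_lt (by omega)]
      simp only [this]
      exact h1
  · rfl
  · refine Subtype.ext (funext fun k => (shift_iterate_apply _ _ k).trans ?_)
    change y ((n + 1 + k) % (n + 1)) = y (k % (n + 1))
    rw [Nat.add_mod_left]
  · intro k hk
    change y k = y (k % (n + 1))
    rw [Nat.mod_eq_of_lt (by omega)]

instance [Countable I] (i : I) (n : ℕ) :
    Countable {x : MarkovShift A // x 0 = i ∧ shift^[n + 1] x = x} := by
  refine Function.Injective.countable
    (f := fun (x : {x : MarkovShift A // x 0 = i ∧ shift^[n + 1] x = x}) =>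
      (fun k : Fin (n + 1) => x.1 k)) fun x y hxy => ?_
  refine Subtype.ext (eq_of_periodic_of_mem_cyl y.2.2 x.2.2 fun k hk => ?_)
  exact congrFun hxy ⟨k, Nat.lt_succ_of_le hk⟩

variable {μ : Measure (MarkovShift A)} {φ : MarkovShift A → ℝ} {P : ℝ} {K : ℕ → ℝ} {c : I → ℝ}

namespace IsLocalWeakGibbs

theorem log_K_nonneg (h : IsLocalWeakGibbs μ φ P K c) (n : ℕ) : 0 ≤ Real.log (K n) :=
  Real.log_nonneg (h.one_le_K n)

theorem log_K_mono (h : IsLocalWeakGibbs μ φ P K c) : Monotone fun n => Real.log (K n) :=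
  fun _ _ hmn => Real.log_le_log (zero_lt_one.trans_le (h.one_le_K _)) (h.mono_K hmn)

theorem log_K_div (h : IsLocalWeakGibbs μ φ P K c) :
    Tendsto (fun n : ℕ => Real.log (K n) / n) atTop (𝓝 0) := by
  simpa [div_eq_inv_mul] using h.subexp_K

theorem log_c_nonneg (h : IsLocalWeakGibbs μ φ P K c) (i : I) : 0 ≤ Real.log (c i) :=
  Real.log_nonneg (h.one_le_c i)

/-- Distinct points of period `n + 1` lie in disjoint `n`-cylinders, whose masses are comparable to
the summands and add up to at most 1. -/
theorem periodicSum_le (h : IsLocalWeakGibbs μ φ P K c) (hφ : Continuous φ) (i : I) (n : ℕ) :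
    periodicSum φ i (n + 1) ≤
      ENNReal.ofReal (Real.exp ((n + 1 : ℕ) * P + Real.log (c i) + Real.log (K (n + 1)))) := by
  have := h.prob
  set E := ENNReal.ofReal (Real.exp ((n + 1 : ℕ) * P + Real.log (c i) + Real.log (K (n + 1))))
  calc periodicSum φ i (n + 1)
      ≤ ∑' x : {x : MarkovShift A // x 0 = i ∧ shift^[n + 1] x = x}, E * μ (cyl n x.1) := by
        refine ENNReal.tsum_le_tsum fun x => ?_
        have h1 := abs_le.1 (h.abs_log_sub_le hφ n x.1)
        rw [x.2.1] at h1
        rw [← ofReal_measureReal, ← ENNReal.ofReal_mul (Real.exp_pos _).le]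
        refine ENNReal.ofReal_le_ofReal ?_
        rw [← Real.exp_log (h.real_pos n x.1), ← Real.exp_add]
        refine Real.exp_le_exp.2 ?_
        linarith [h1.1]
    _ = E * ∑' x : {x : MarkovShift A // x 0 = i ∧ shift^[n + 1] x = x}, μ (cyl n x.1) :=
        ENNReal.tsum_mul_left
    _ ≤ E * 1 := by
        gcongr
        refine (tsum_meas_le_meas_iUnion_of_disjoint μ
          (As := fun x : {x : MarkovShift A // x 0 = i ∧ shift^[n + 1] x = x} => cyl n x.1)
          (fun x => measurableSet_cyl n x.1) fun x y hxy => ?_).trans prob_le_one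
        refine Set.disjoint_left.2 fun z hx hy => hxy (Subtype.ext ?_)
        refine eq_of_periodic_of_mem_cyl y.2.2 x.2.2 ?_
        rw [← cyl_eq_of_mem hy, cyl_eq_of_mem hx]
        exact mem_cyl_self _ _
    _ = E := mul_one _

theorem gurevichPressure_le (h : IsLocalWeakGibbs μ φ P K c) (hφ : Continuous φ) :
    gurevichPressure φ ≤ P := by
  refine iSup_le fun i => ?_
  have ht : Tendsto (fun n : ℕ => (((n * P + Real.log (c i) + Real.log (K n)) / n : ℝ) : EReal))
      atTop (𝓝 (P : EReal)) := by
    refine (continuous_coe_real_ereal.tendsto P).comp ?_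
    have h1 : Tendsto (fun n : ℕ => P + Real.log (c i) / n + Real.log (K n) / n) atTop
        (𝓝 (P + 0 + 0)) :=
      (tendsto_const_nhds.add (tendsto_const_div_atTop_nhds_zero_nat _)).add h.log_K_div
    rw [add_zero, add_zero] at h1
    refine h1.congr' ?_
    filter_upwards [eventually_gt_atTop 0] with n hn
    field_simp
  rw [← ht.limsup_eq]
  refine limsup_le_limsup ?_
  filter_upwards [eventually_gt_atTop 0] with n hn
  obtain ⟨k, rfl⟩ := Nat.exists_eq_succ_of_ne_zero hn.ne'
  have h1 := ENNReal.log_monotone (h.periodicSum_le hφ i k)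
  rw [ENNReal.log_ofReal_of_pos (Real.exp_pos _), Real.log_exp] at h1
  rw [EReal.coe_div]
  exact EReal.div_le_div_right_of_nonneg (by positivity) h1

theorem measure_return_le [Countable I] (h : IsLocalWeakGibbs μ φ P K c) (hφ : Continuous φ)
    (w : MarkovShift A) (n : ℕ) :
    μ (cyl 0 w ∩ shift^[n + 1] ⁻¹' cyl 0 w) ≤
      ENNReal.ofReal (Real.exp (-((n + 1 : ℕ) : ℝ) * P + Real.log (c (w 0)) +
        Real.log (K (n + 1)))) * periodicSum φ (w 0) (n + 1) := by
  have := h.prob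
  rw [periodicSum, ← ENNReal.tsum_mul_left]
  refine (measure_mono (t := ⋃ x : {x : MarkovShift A // x 0 = w 0 ∧ shift^[n + 1] x = x},
    cyl n x.1) ?_).trans ((measure_iUnion_le _).trans (ENNReal.tsum_le_tsum fun x => ?_))
  · rintro y ⟨hy0, hy1⟩
    have e0 : y 0 = w 0 := hy0 0 le_rfl
    have e1 : y (n + 1) = w 0 := by
      have := hy1 0 le_rfl
      rwa [shift_iterate_apply] at this
    obtain ⟨x, hx0, hx1, hx⟩ := exists_periodic_mem_cyl (e1.trans e0.symm)
    exact mem_iUnion.2 ⟨⟨x, hx0.trans e0, hx1⟩, hx⟩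
  · have h1 := abs_le.1 (h.abs_log_sub_le hφ n x.1)
    rw [x.2.1] at h1
    rw [← ofReal_measureReal, ← ENNReal.ofReal_mul (Real.exp_pos _).le]
    refine ENNReal.ofReal_le_ofReal ?_
    rw [← Real.exp_log (h.real_pos n x.1), ← Real.exp_add]
    refine Real.exp_le_exp.2 ?_
    linarith [h1.2]

/-- If `periodicSum` grew more slowly than `exp (n * P)`, the masses of the returns to `cyl 0 w`
would be summable by `measure_return_le`, and Borel–Cantelli would contradict Poincaré recurrence.
-/
theorem le_gurevichPressure [Countable I] (h : IsLocalWeakGibbs μ φ P K c) (hφ : Continuous φ)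
    (hinv : MeasurePreserving shift μ μ) (w : MarkovShift A) :
    (P : EReal) ≤ gurevichPressure φ := by
  have := h.prob
  refine le_iSup_of_le (w 0) ?_
  by_contra! hlt
  obtain ⟨r, hr1, hr2⟩ := EReal.lt_iff_exists_real_btwn.1 hlt
  have hrP : r < P := by exact_mod_cast hr2
  have hsum : ∑' n, μ (cyl 0 w ∩ shift^[n] ⁻¹' cyl 0 w) ≠ ∞ := by
    have hev : ∀ᶠ n : ℕ in atTop, μ (cyl 0 w ∩ shift^[n] ⁻¹' cyl 0 w) ≤
        ENNReal.ofReal (Real.exp (-((P - r) / 2)) ^ n) := by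
      -- Half of the gap `P - r` absorbs the Gibbs constants; the other half leaves a geometric
      -- series.
      have hK := (h.log_K_div.add (tendsto_const_div_atTop_nhds_zero_nat
        (Real.log (c (w 0))))).eventually (gt_mem_nhds (show (0 : ℝ) + 0 < (P - r) / 2 by linarith))
      filter_upwards [eventually_lt_of_limsup_lt hr1, eventually_gt_atTop 0, hK] with n hn hn0 hK
      obtain ⟨k, rfl⟩ := Nat.exists_eq_succ_of_ne_zero hn0.ne'
      have hk : (0 : ℝ) < (k + 1 : ℕ) := by positivity
      have hZ : periodicSum φ (w 0) (k + 1) ≤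
          ENNReal.ofReal (Real.exp ((k + 1 : ℕ) * r)) := by
        rw [← ENNReal.log_le_log_iff, ENNReal.log_ofReal_of_pos (Real.exp_pos _), Real.log_exp]
        have := (EReal.div_lt_iff (by exact_mod_cast hk) (EReal.natCast_ne_top _)).1 hn
        refine this.le.trans (le_of_eq ?_)
        rw [mul_comm, EReal.coe_mul]
        rfl
      refine (h.measure_return_le hφ w k).trans ((mul_le_mul_right hZ _).trans ?_)
      rw [← ENNReal.ofReal_mul (Real.exp_pos _).le, ← Real.exp_add, ← Real.exp_nat_mul]
      refine ENNReal.ofReal_le_ofReal (Real.exp_le_exp.2 ?_)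
      rw [← add_div, div_lt_iff₀ hk] at hK
      simp only [Nat.succ_eq_add_one] at hK ⊢
      linarith
    obtain ⟨n0, hn0⟩ := eventually_atTop.1 hev
    have hlt1 : Real.exp (-((P - r) / 2)) < 1 := Real.exp_lt_one_iff.2 (by linarith)
    rw [← Summable.sum_add_tsum_nat_add' (k := n0) ENNReal.summable]
    refine ENNReal.add_ne_top.2 ⟨(ENNReal.sum_lt_top.2 fun _ _ => measure_lt_top _ _).ne, ?_⟩
    refine ne_top_of_le_ne_top ?_ (ENNReal.tsum_le_tsum fun n => hn0 (n + n0) (by omega))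
    refine ((summable_nat_add_iff n0).2 (summable_geometric_of_lt_one (Real.exp_pos _).le
      hlt1)).tsum_ofReal_ne_top
  have h0 := measure_limsup_atTop_eq_zero hsum
  have hcons := (hinv.conservative).ae_mem_imp_frequently_image_mem
    (measurableSet_cyl 0 w).nullMeasurableSet
  obtain ⟨z, hz, hz1, hz2⟩ := ((frequently_ae_mem_iff.2 (h.pos 0 w).ne').and_eventually
    (hcons.and (measure_eq_zero_iff_ae_notMem.1 h0))).exists
  refine hz2 (mem_limsup_iff_frequently_mem.2 ((hz1 hz).mono fun n hn => ⟨hz, hn⟩))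

end IsLocalWeakGibbs

end MarkovShift

/-! ### Subadditive majorants, hitting indices and covering arguments. -/

/-- A nondecreasing sequence `o(n)` has a nondecreasing subadditive majorant `o(n)`. -/
theorem exists_subadditive_majorant {κ : ℕ → ℝ} (hmono : Monotone κ) (h0 : ∀ n, 0 ≤ κ n)
    (hdiv : Tendsto (fun n : ℕ => κ n / n) atTop (𝓝 0)) :
    ∃ L : ℕ → ℝ, (∀ n, 0 ≤ L n) ∧ Monotone L ∧ (∀ a b, L (a + b) ≤ L a + L b) ∧
      (∀ n, 1 ≤ n → κ n ≤ L n) ∧ Tendsto (fun n : ℕ => L n / n) atTop (𝓝 0) ∧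
      (BddAbove (range κ) → ∀ n, L n = L 0) := by
  by_cases hb : BddAbove (range κ)
  · have hM : 0 ≤ sSup (range κ) := (h0 0).trans (le_csSup hb ⟨0, rfl⟩)
    exact ⟨fun _ => sSup (range κ), fun _ => hM, monotone_const, fun _ _ => by linarith,
      fun n _ => le_csSup hb ⟨n, rfl⟩, tendsto_const_div_atTop_nhds_zero_nat _, fun _ _ => rfl⟩
  obtain ⟨M, hM⟩ := hdiv.bddAbove_range
  have hM' : ∀ k, κ k / k ≤ M := fun k => hM ⟨k, rfl⟩
  have hM0 : 0 ≤ M := (div_nonneg (h0 0) (Nat.cast_nonneg _)).trans (hM' 0)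
  have hbd : ∀ m : ℕ, BddAbove (range fun k : ℕ => κ k * min 1 ((m : ℝ) / k)) := by
    refine fun m => ⟨M * m, ?_⟩
    rintro _ ⟨k, rfl⟩
    calc κ k * min 1 ((m : ℝ) / k) ≤ κ k * (m / k) :=
          mul_le_mul_of_nonneg_left (min_le_right _ _) (h0 k)
      _ = κ k / k * m := by ring
      _ ≤ M * m := mul_le_mul_of_nonneg_right (hM' k) (Nat.cast_nonneg _)
  have hle : ∀ m k : ℕ, κ k * min 1 ((m : ℝ) / k) ≤ ⨆ k : ℕ, κ k * min 1 ((m : ℝ) / k) :=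
    fun m k => le_ciSup (hbd m) k
  -- Each `m ↦ min 1 (m / k)` is monotone and subadditive and equals 1 at `m = k`, hence so behaves
  -- the supremum. The term `k = 0` is zero because `m / 0 = 0`.
  refine ⟨fun m => ⨆ k : ℕ, κ k * min 1 ((m : ℝ) / k), fun n => ?_, fun a b hab => ?_,
    fun a b => ?_, fun n hn => ?_, ?_, fun h => absurd h hb⟩
  · refine le_trans ?_ (hle n 0)
    simp
  · refine ciSup_le fun k => le_trans ?_ (hle b k)
    refine mul_le_mul_of_nonneg_left (min_le_min le_rfl ?_) (h0 k)
    gcongr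
  · refine ciSup_le fun k => le_trans ?_ (add_le_add (hle a k) (hle b k))
    rw [← mul_add]
    refine mul_le_mul_of_nonneg_left ?_ (h0 k)
    have ha : (0 : ℝ) ≤ a / k := by positivity
    have hb : (0 : ℝ) ≤ b / k := by positivity
    have hab : ((a + b : ℕ) : ℝ) / k = a / k + b / k := by push_cast; ring
    rw [hab]
    rcases min_cases (1 : ℝ) (a / k) with h | h <;> rcases min_cases (1 : ℝ) (b / k) with h' | h'
    · linarith [min_le_left (1 : ℝ) (a / k + b / k)]
    · linarith [min_le_left (1 : ℝ) (a / k + b / k)]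
    · linarith [min_le_left (1 : ℝ) (a / k + b / k)]
    · linarith [min_le_right (1 : ℝ) (a / k + b / k)]
  · have hn' : (n : ℝ) ≠ 0 := by positivity
    simpa [div_self hn'] using hle n n
  · rw [Metric.tendsto_atTop]
    intro ε hε
    obtain ⟨k0, hk0⟩ := eventually_atTop.1 (hdiv.eventually (gt_mem_nhds (half_pos hε)))
    obtain ⟨n0, hn0⟩ := eventually_atTop.1
      ((tendsto_const_div_atTop_nhds_zero_nat (κ k0)).eventually (gt_mem_nhds (half_pos hε)))
    refine ⟨max n0 1, fun n hn => ?_⟩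
    have hn1 : (0 : ℝ) < n := by
      have : 1 ≤ n := (le_max_right _ _).trans hn
      positivity
    have hnn : 0 ≤ ⨆ k : ℕ, κ k * min 1 ((n : ℝ) / k) := le_trans (by simp) (hle n 0)
    rw [Real.dist_eq, sub_zero, abs_of_nonneg (by positivity)]
    refine lt_of_le_of_lt ?_ (half_lt_self hε)
    rw [div_le_iff₀ hn1]
    refine ciSup_le fun k => ?_
    rcases le_total k k0 with hk | hk
    · calc κ k * min 1 ((n : ℝ) / k) ≤ κ k * 1 :=
            mul_le_mul_of_nonneg_left (min_le_left _ _) (h0 k)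
        _ ≤ κ k0 := by rw [mul_one]; exact hmono hk
        _ ≤ ε / 2 * n := ((div_lt_iff₀ hn1).1 (hn0 n ((le_max_left _ _).trans hn))).le
    · calc κ k * min 1 ((n : ℝ) / k) ≤ κ k * (n / k) :=
            mul_le_mul_of_nonneg_left (min_le_right _ _) (h0 k)
        _ = κ k / k * n := by ring
        _ ≤ ε / 2 * n := mul_le_mul_of_nonneg_right (hk0 k hk).le hn1.le

theorem subadditive_nat_mul_le {L : ℕ → ℝ}
    (hadd : ∀ a b, L (a + b) ≤ L a + L b) {R : ℕ} (hR : 1 ≤ R) (n : ℕ) :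
    L (R * n) ≤ R * L n := by
  induction R, hR using Nat.le_induction with
  | base => simp
  | succ R _ ih =>
    have := hadd (R * n) n
    rw [Nat.succ_mul]
    push_cast
    linarith

/-- If `g (l n) ≤ S₁ n` eventually and `S₁ < S₂`, then for infinitely many `n` there is `i` with
`l n ≤ p i` and `g (p i) ≤ S₂ n`; moreover `p i = O(n)` if `l n = O(n)`. -/
theorem frequently_exists_le_of_strictMono {g : ℕ → ℝ} (hg : Monotone g) {l p : ℕ → ℕ}
    (hp : StrictMono p) {S₁ S₂ : ℝ} (hS : S₁ < S₂) (hS₂ : 0 < S₂)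
    (hl : ∀ᶠ n in atTop, g (l n) ≤ S₁ * n) {D : Prop} {R : ℕ} (hR : 1 ≤ R)
    (hD : D → ∀ᶠ n in atTop, l n ≤ R * n) :
    ∃ᶠ n in atTop, ∃ i, l n ≤ p i ∧ g (p i) ≤ S₂ * n ∧ (D → p i ≤ 2 * R * n) := by
  classical
  have hD' : ∀ᶠ n in atTop, D → l n ≤ R * n := by
    by_cases h : D
    · filter_upwards [hD h] with n hn _ using hn
    · exact Eventually.of_forall fun _ h' => absurd h' h
  have hex : ∀ n, ∃ i, l n ≤ p i := fun n => ⟨l n, hp.le_apply⟩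
  have hlim : Tendsto (fun n : ℕ => (S₂ - S₁) * (n : ℝ)) atTop atTop :=
    (tendsto_natCast_atTop_atTop).const_mul_atTop (sub_pos.2 hS)
  intro hbad
  obtain ⟨n0, hn0⟩ := eventually_atTop.1 (hbad.and ((tendsto_add_atTop_nat 1).eventually
    (hl.and hD') |>.and ((hlim.eventually_ge_atTop S₁).and (eventually_ge_atTop 1))))
  -- If the first admissible index jumped between `n` and `n + 1`, the old `p i` would be below `l
  -- (n + 1)`, hence `g (p i) ≤ S₁ * (n + 1) ≤ S₂ * n`, a good index at time `n`. So without good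
  -- times the first index never increases, and `p i` stays bounded, which is itself good for large
  -- `n`.
  have hstep : ∀ n ≥ n0, Nat.find (hex (n + 1)) ≤ Nat.find (hex n) := by
    intro n hn
    by_contra! hlt
    obtain ⟨h1, ⟨h2, h3⟩, h4, h5⟩ := hn0 n hn
    have hlt' : p (Nat.find (hex n)) < l (n + 1) := not_le.1 (Nat.find_min (hex (n + 1)) hlt)
    refine h1 ⟨_, Nat.find_spec (hex n), ?_, fun hd => ?_⟩
    · have := hg hlt'.le
      push_cast at h2
      nlinarith
    · have := h3 hd
      nlinarith
  have hanti : ∀ k, Nat.find (hex (n0 + k)) ≤ Nat.find (hex n0) := by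
    intro k
    induction k with
    | zero => rfl
    | succ k ih => exact (hstep (n0 + k) (by omega)).trans ih
  set q := p (Nat.find (hex n0)) with hq
  have hlim2 : Tendsto (fun n : ℕ => S₂ * (n : ℝ)) atTop atTop :=
    (tendsto_natCast_atTop_atTop).const_mul_atTop hS₂
  obtain ⟨n, h1, h2, h3⟩ := ((hlim2.eventually_ge_atTop (g q)).and
    ((eventually_ge_atTop n0).and (eventually_ge_atTop q))).exists
  obtain ⟨k, rfl⟩ := Nat.exists_eq_add_of_le h2
  have hpq : p (Nat.find (hex (n0 + k))) ≤ q := hp.monotone (hanti k)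
  refine (hn0 _ h2).1 ⟨_, Nat.find_spec (hex (n0 + k)), (hg hpq).trans h1, fun _ => ?_⟩
  nlinarith

/-- Since `ψ ≤ 1`, lowering the exponent only increases the sums, so a bound at the single exponent
`t` suffices, over covers of any diameter. -/
theorem le_caratheodoryDim {X : Type*} [MetricSpace X] {F : Set (Set X)} {ψ : Set X → ℝ≥0∞}
    {E : Set X} {t : ℝ} (hψ : ∀ B ∈ F, ψ B ≤ 1) {κ : ℝ≥0∞} (hκ : 0 < κ)
    (h : ∀ U : Set (Set X), U ⊆ F → E ⊆ ⋃₀ U → κ ≤ ∑' B : U, ψ B.1 ^ t) :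
    ENNReal.ofReal t ≤ caratheodoryDim F ψ E := by
  refine le_iInf₂ fun α hα => ?_
  by_contra! hlt
  have hαt : (α : ℝ) ≤ t := by
    rcases le_total t 0 with ht | ht
    · rw [ENNReal.ofReal_of_nonpos ht] at hlt
      exact absurd hlt (not_lt.2 bot_le)
    · rw [← ENNReal.ofReal_coe_nnreal] at hlt
      exact (ENNReal.ofReal_le_ofReal_iff ht).1 hlt.le
  refine hκ.not_ge (le_trans ?_ hα.le)
  refine le_iSup₂_of_le 1 one_pos (le_iInf₂ fun U hU => (h U hU.2.1 hU.2.2.1).trans ?_)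
  exact ENNReal.tsum_le_tsum fun B => ENNReal.rpow_le_rpow_of_exponent_ge (hψ _ (hU.2.1 B.2)) hαt

/-- If the sets of a family `𝒰` lying in `U` have total mass less than `∑ q v`, and every such set
`F` has mass at least the sum of the `q v` over the `v` with `T v ⊆ F`, then one of the sets `T v`
lies in no member of `𝒰`, and the members of `𝒰` lying in `T v` have total mass less than `q v`. -/
theorem exists_uncovered_child {X ι : Type*} {ψ : Set X → ℝ≥0∞} {𝒰 : Set (Set X)} {U : Set X}
    {T : ι → Set X} {q : ι → ℝ≥0∞}
    (hlt : ∑' F : {F // F ∈ 𝒰 ∧ F ⊆ U}, ψ F.1 < ∑' v, q v) (hTU : ∀ v, T v ⊆ U)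
    (hT : ∀ v, (T v).Nonempty) (hdisj : ∀ v v', (T v ∩ T v').Nonempty → v = v')
    (h𝒰 : ∀ F ∈ 𝒰, F.Nonempty) (hnest : ∀ v, ∀ F ∈ 𝒰, T v ⊆ F → F ⊆ U)
    (hF : ∀ F ∈ 𝒰, F ⊆ U → ∑' v : {v // T v ⊆ F}, q v.1 ≤ ψ F) :
    ∃ v, (∀ F ∈ 𝒰, ¬ T v ⊆ F) ∧ ∑' F : {F // F ∈ 𝒰 ∧ F ⊆ T v}, ψ F.1 < q v := by
  classical
  by_contra! hcon
  refine hlt.not_ge ?_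
  -- Double counting: under the contrary assumption row `v` sums to at least `q v`, while column `F`
  -- sums to at most `ψ F`, since `F` either lies properly in one `T v` or meets the table only
  -- through the `T v` that it contains.
  let a : ι → {F // F ∈ 𝒰 ∧ F ⊆ U} → ℝ≥0∞ := fun v F =>
    if T v ⊆ F.1 then q v else if F.1 ⊆ T v then ψ F.1 else 0
  calc ∑' v, q v ≤ ∑' v, ∑' F, a v F := ENNReal.tsum_le_tsum fun v => ?_
    _ = ∑' F, ∑' v, a v F := ENNReal.tsum_comm
    _ ≤ ∑' F : {F // F ∈ 𝒰 ∧ F ⊆ U}, ψ F.1 := ENNReal.tsum_le_tsum fun F => ?_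
  · by_cases hv : ∃ F ∈ 𝒰, T v ⊆ F
    · obtain ⟨F, hF1, hF2⟩ := hv
      refine le_trans ?_ (ENNReal.le_tsum ⟨F, hF1, hnest v F hF1 hF2⟩)
      simp [a, hF2]
    · push Not at hv
      refine (hcon v hv).trans ?_
      let e : {F // F ∈ 𝒰 ∧ F ⊆ T v} → {F // F ∈ 𝒰 ∧ F ⊆ U} :=
        fun F => ⟨F.1, F.2.1, F.2.2.trans (hTU v)⟩
      have he : Function.Injective e := fun F G h =>
        Subtype.ext (congrArg (fun H : {F // F ∈ 𝒰 ∧ F ⊆ U} => H.1) h)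
      refine le_trans (ENNReal.tsum_le_tsum fun F => ?_)
        (ENNReal.tsum_comp_le_tsum_of_injective he (a v))
      simp [a, e, hv _ F.2.1, F.2.2]
  · by_cases hv : ∃ v, F.1 ⊆ T v ∧ ¬ T v ⊆ F.1
    · obtain ⟨v, hv1, hv2⟩ := hv
      rw [tsum_eq_single v]
      · simp [a, hv1, hv2]
      · intro v' hne
        have h1 : ¬ T v' ⊆ F.1 := fun h => hne (hdisj _ _ (by
          rw [inter_eq_left.2 (h.trans hv1)]
          exact hT v'))
        have h2 : ¬ F.1 ⊆ T v' := fun h => hne (hdisj _ _ ((h𝒰 F.1 F.2.1).mono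
          (subset_inter h hv1)))
        simp [a, h1, h2]
    · push Not at hv
      refine le_trans ?_ (hF F.1 F.2.1 F.2.2)
      refine le_of_eq ((tsum_congr fun v => ?_).trans (tsum_subtype {v | T v ⊆ F.1} q).symm)
      by_cases h : T v ⊆ F.1
      · simp [a, h]
      · have : ¬ F.1 ⊆ T v := fun h' => h (hv v h')
        simp [a, h, this]

/-! ### Weights on a pattern and the mass distribution principle. -/

namespace MarkovShift

variable {I : Type*} {A : I → I → Prop} {μ m : Measure (MarkovShift A)}

theorem injOn_shift_iterate {n d : ℕ} (h : d ≤ n + 1) (x : MarkovShift A) :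
    InjOn shift^[d] (cyl n x) := by
  intro y hy z hz hyz
  refine Subtype.ext (funext fun k => ?_)
  rcases le_or_gt k n with hk | hk
  · exact (hy k hk).trans (hz k hk).symm
  · have h1 := shift_iterate_apply d y (k - d)
    have h2 := shift_iterate_apply d z (k - d)
    rw [hyz, h2] at h1
    rw [show d + (k - d) = k by omega] at h1
    exact h1.symm

theorem shift_image_cyl_pos (hμ : ∀ n (x : MarkovShift A), 0 < μ.real (cyl n x)) {d n : ℕ}
    (h : d ≤ n) (x : MarkovShift A) : 0 < μ.real (shift^[d] '' cyl n x) := by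
  rw [shift_image_cyl h]
  exact hμ _ _

/-- A point of all sets of a decreasing sequence of cylinders of increasing depth. -/
theorem exists_mem_of_antitone {d : ℕ → ℕ} (hd : StrictMono d) {U : ℕ → Set (MarkovShift A)}
    (hU : ∀ j, IsCyl (d j) (U j)) (hanti : Antitone U) : ∃ z, ∀ j, z ∈ U j := by
  choose x hx using hU
  have hmem : ∀ i j, i ≤ j → ∀ k ≤ d i, x j k = x i k := by
    intro i j hij
    have : x j ∈ U i := hanti hij (by rw [hx j]; exact mem_cyl_self _ _)
    rw [hx i] at this
    exact this
  refine ⟨⟨fun k => x k k, fun k => ?_⟩, fun j => ?_⟩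
  · change A (x k k) (x (k + 1) (k + 1))
    rw [← hmem k (k + 1) (by omega) k hd.le_apply]
    exact (x (k + 1)).2 k
  · rw [hx j]
    intro k hk
    change x k k = x j k
    rcases le_total k j with h | h
    · exact (hmem k j h k hd.le_apply).symm
    · exact hmem j k h k hk

theorem IsPattern.strictMono {dt d : ℕ → ℕ} {Jt J : ℕ → Set (Set (MarkovShift A))}
    {J0 : Set (MarkovShift A)} (h : IsPattern dt d Jt J J0) : StrictMono d :=
  strictMono_nat_of_lt_succ fun j => (h.lt j).trans_le (h.le j)

section Weights

variable {a : I} {w : MarkovShift A} {p : ℕ → ℕ} {s γ : ℕ → ℝ} {t δ C : ℝ} {dt d : ℕ → ℕ}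
  {Jt J : ℕ → Set (Set (MarkovShift A))} {J0 : Set (MarkovShift A)}

/-- The share of `V` in the weight of `U`, taken in proportion to m-mass, does not exceed the weight
of the unique `T` in `V`. The hypothesis `hlast` carries no constant `C`; this is what allows
iteration over all levels. -/
theorem child_weight_le (hμ : ∀ n (x : MarkovShift A), 0 < μ.real (cyl n x))
    (hm : ∀ n (x : MarkovShift A), 0 < m.real (cyl n x))
    (hs : IsDistortionSeq μ a w p s) (ht : 0 < t) (hδ : 0 < δ)
    (hpat : IsPattern dt d Jt J J0)
    (hstart : ∀ j, ∀ U ∈ J j, ∀ z ∈ U, z 0 = a ∧ ∃ i, z (d j) = w (p i))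
    (hlower : ∀ j, ∀ V ∈ Jt (j + 1), ∀ U ∈ J (j + 1), U ⊆ V →
      Real.exp (-γ (j + 1)) ≤ shiftRatio μ (d j) U V)
    (hlast : ∀ j, ∀ U ∈ J j, ∀ z : MarkovShift A, cyl (dt (j + 1)) z ⊆ U →
      shiftRatio m (d j) (cyl (dt (j + 1)) z) U ≤
        δ * (Real.exp (-γ (j + 1)) / s (d (j + 1)) ^ 2 *
          shiftRatio μ (d j) (cyl (dt (j + 1)) z) U) ^ t)
    {j : ℕ} {U V T : Set (MarkovShift A)} (hU : U ∈ J j) (hV : V ∈ Jt (j + 1))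
    (hT : T ∈ J (j + 1)) (hVU : V ⊆ U) (hTV : T ⊆ V) :
    (μ.real U / s (d j)) ^ t / (δ * m.real (shift^[d j] '' U)) * m.real (shift^[d j] '' V) ≤
      (μ.real T / s (d (j + 1))) ^ t := by
  obtain ⟨z, rfl⟩ := hpat.isCyl _ T hT
  have hzT := mem_cyl_self (d (j + 1)) z
  obtain ⟨v, rfl⟩ := hpat.isCyl_tilde _ V hV
  obtain ⟨x, rfl⟩ := hpat.isCyl _ U hU
  have eV := cyl_eq_of_mem (hTV hzT)
  have eU := cyl_eq_of_mem (hVU (hTV hzT))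
  have hlow := hlower j _ hV _ hT hTV
  rw [← eV] at hVU hlow ⊢
  have hla := hlast j _ hU _ hVU
  obtain ⟨h0, i, hi⟩ := hstart j _ hU z (hVU (mem_cyl_self _ z))
  rw [← eU] at hla ⊢
  have hlt := hpat.lt j
  have hle := hpat.le j
  have hcomp := (hs.compare z (d j) i h0 hi (d (j + 1)) (by omega)).1
  have s1 := hs.one_le (d j)
  have s2 := hs.one_le (d (j + 1))
  have pU := hμ (d j) z
  have pT := hμ (d (j + 1)) z
  have qV := shift_image_cyl_pos hμ hlt.le z
  have qU := shift_image_cyl_pos hμ (le_refl (d j)) z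
  have qT := shift_image_cyl_pos hμ (show d j ≤ d (j + 1) by omega) z
  have mU := shift_image_cyl_pos hm (le_refl (d j)) z
  unfold shiftRatio at *
  set X := Real.exp (-γ (j + 1)) / s (d (j + 1)) ^ 2 *
    (μ.real (shift^[d j] '' cyl (dt (j + 1)) z) / μ.real (shift^[d j] '' cyl (d j) z)) with hX
  have hX0 : 0 ≤ X := by positivity
  -- The factor `exp (-γ)` is traded for the passage from `V` to `T`. Of the two factors `1 / s`,
  -- one pays for the distortion of `shift^[d j]`, the other is kept for the weight of `T`.
  have hX1 : X ≤ 1 / s (d (j + 1)) * (μ.real (cyl (d (j + 1)) z) / μ.real (cyl (d j) z)) := by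
    calc X ≤ (μ.real (shift^[d j] '' cyl (d (j + 1)) z) /
              μ.real (shift^[d j] '' cyl (dt (j + 1)) z)) / s (d (j + 1)) ^ 2 *
            (μ.real (shift^[d j] '' cyl (dt (j + 1)) z) /
              μ.real (shift^[d j] '' cyl (d j) z)) := by
          rw [hX]; gcongr
      _ = 1 / s (d (j + 1)) * (1 / s (d (j + 1)) * (μ.real (shift^[d j] '' cyl (d (j + 1)) z) /
              μ.real (shift^[d j] '' cyl (d j) z))) := by
          field_simp
      _ ≤ _ := by gcongr
  calc (μ.real (cyl (d j) z) / s (d j)) ^ t / (δ * m.real (shift^[d j] '' cyl (d j) z)) *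
        m.real (shift^[d j] '' cyl (dt (j + 1)) z)
      = (μ.real (cyl (d j) z) / s (d j)) ^ t / δ * (m.real (shift^[d j] '' cyl (dt (j + 1)) z) /
          m.real (shift^[d j] '' cyl (d j) z)) := by field_simp
    _ ≤ (μ.real (cyl (d j) z) / s (d j)) ^ t / δ * (δ * X ^ t) := by gcongr
    _ = (μ.real (cyl (d j) z) / s (d j) * X) ^ t := by
        rw [Real.mul_rpow (by positivity) hX0]; field_simp
    _ ≤ (μ.real (cyl (d j) z) * (1 / s (d (j + 1)) *
          (μ.real (cyl (d (j + 1)) z) / μ.real (cyl (d j) z)))) ^ t := by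
        gcongr
        exact div_le_self pU.le s1
    _ = _ := by congr 1; field_simp

/-- Here `C` does appear, but only once, against the prefactor `1 / C`; the factor `s (d j)` in the
estimate cancels the one in the weight of `U`. -/
theorem intermediate_weight_le (hμ : ∀ n (x : MarkovShift A), 0 < μ.real (cyl n x))
    (hm : ∀ n (x : MarkovShift A), 0 < m.real (cyl n x))
    (hs : IsDistortionSeq μ a w p s) (ht : 0 < t) (hδ : 0 < δ) (hC : 0 < C)
    (hpat : IsPattern dt d Jt J J0)
    (hstart : ∀ j, ∀ U ∈ J j, ∀ z ∈ U, z 0 = a ∧ ∃ i, z (d j) = w (p i))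
    (hest : PatternEstimates μ m t γ s δ C dt d Jt J)
    {j n : ℕ} {U : Set (MarkovShift A)} {z : MarkovShift A} (hU : U ∈ J j) (hzU : cyl n z ⊆ U)
    (hn : d j < n) (hn' : n < dt (j + 1)) :
    1 / C * (μ.real U / s (d j)) ^ t / (δ * m.real (shift^[d j] '' U)) *
      m.real (shift^[d j] '' cyl n z) ≤ μ.real (cyl n z) ^ t := by
  obtain ⟨x, rfl⟩ := hpat.isCyl _ U hU
  have eU := cyl_eq_of_mem (hzU (mem_cyl_self n z))
  have hup := hest.upper j _ hU z n hn.le hn' hzU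
  obtain ⟨h0, i, hi⟩ := hstart j _ hU z (hzU (mem_cyl_self _ z))
  rw [← eU] at hup ⊢
  have hcomp := (hs.compare z (d j) i h0 hi n hn).1
  have s1 := hs.one_le (d j)
  have s2 := hs.one_le n
  have pU := hμ (d j) z
  have pT := hμ n z
  have qV := shift_image_cyl_pos hμ hn.le z
  have qU := shift_image_cyl_pos hμ (le_refl (d j)) z
  have mU := shift_image_cyl_pos hm (le_refl (d j)) z
  unfold shiftRatio at *
  set X := s (d j) / s n *
    (μ.real (shift^[d j] '' cyl n z) / μ.real (shift^[d j] '' cyl (d j) z)) with hX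
  have hX0 : 0 ≤ X := by positivity
  have hX1 : X ≤ s (d j) * (μ.real (cyl n z) / μ.real (cyl (d j) z)) := by
    calc X = s (d j) * (1 / s n * (μ.real (shift^[d j] '' cyl n z) /
              μ.real (shift^[d j] '' cyl (d j) z))) := by rw [hX]; ring
      _ ≤ _ := by gcongr
  calc 1 / C * (μ.real (cyl (d j) z) / s (d j)) ^ t / (δ * m.real (shift^[d j] '' cyl (d j) z)) *
        m.real (shift^[d j] '' cyl n z)
      = (μ.real (cyl (d j) z) / s (d j)) ^ t / (C * δ) * (m.real (shift^[d j] '' cyl n z) /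
          m.real (shift^[d j] '' cyl (d j) z)) := by field_simp
    _ ≤ (μ.real (cyl (d j) z) / s (d j)) ^ t / (C * δ) * (C * δ * X ^ t) := by gcongr
    _ = (μ.real (cyl (d j) z) / s (d j) * X) ^ t := by
        rw [Real.mul_rpow (by positivity) hX0]; field_simp
    _ ≤ (μ.real (cyl (d j) z) / s (d j) * (s (d j) *
          (μ.real (cyl n z) / μ.real (cyl (d j) z)))) ^ t := by
        gcongr
    _ = _ := by congr 1; field_simp

end Weights

end MarkovShift

namespace MarkovShift

variable {I : Type*} {A : I → I → Prop} {μ m : Measure (MarkovShift A)}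
  {a : I} {w : MarkovShift A} {p : ℕ → ℕ} {s γ : ℕ → ℝ} {t δ C : ℝ} {dt d : ℕ → ℕ}
  {Jt J : ℕ → Set (Set (MarkovShift A))} {J0 : Set (MarkovShift A)}

/-- The iterate of the shift is injective on the cylinder `U`, so the images of disjoint cylinders
in it remain disjoint. -/
theorem tsum_measure_shift_image_le {d n n' : ℕ} (hd : d ≤ n) {ι : Type*}
    {V : ι → Set (MarkovShift A)} (hV : ∀ i, IsCyl n (V i)) (hinj : Function.Injective V)
    {F U : Set (MarkovShift A)} (hU : IsCyl n' U) (hdn' : d ≤ n' + 1)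
    (hVF : ∀ i, V i ⊆ F) (hFU : F ⊆ U) :
    ∑' i, m (shift^[d] '' V i) ≤ m (shift^[d] '' F) := by
  obtain ⟨x, rfl⟩ := hU
  refine (tsum_meas_le_meas_iUnion_of_disjoint m (fun i => ?_) fun i i' hne => ?_).trans
    (measure_mono (iUnion_subset fun i => image_mono (hVF i)))
  · obtain ⟨v, hv⟩ := hV i
    rw [hv, shift_image_cyl hd]
    exact measurableSet_cyl _ _
  · refine Set.disjoint_left.2 ?_
    rintro _ ⟨y, hy, rfl⟩ ⟨y', hy', hyy⟩
    have : y' = y := injOn_shift_iterate hdn' x (hFU (hVF _ hy')) (hFU (hVF _ hy)) hyy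
    subst this
    refine hne (hinj ?_)
    obtain ⟨v, hv⟩ := hV i
    obtain ⟨v', hv'⟩ := hV i'
    rw [hv] at hy ⊢
    rw [hv'] at hy' ⊢
    rw [← cyl_eq_of_mem hy, cyl_eq_of_mem hy']

/-- A family of cylinders of small total mass which does not swallow an element `U` of a pattern
does not swallow some child of `U` either, and has small total mass in this child. -/
theorem exists_uncovered_pattern_child [IsFiniteMeasure μ] [IsFiniteMeasure m]
    (hμ : ∀ n (x : MarkovShift A), 0 < μ.real (cyl n x))
    (hm : ∀ n (x : MarkovShift A), 0 < m.real (cyl n x))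
    (hs : IsDistortionSeq μ a w p s) (ht : 0 < t) (hδ : 0 < δ) (hC : 1 ≤ C)
    (hpat : IsPattern dt d Jt J J0)
    (hstart : ∀ j, ∀ U ∈ J j, ∀ z ∈ U, z 0 = a ∧ ∃ i, z (d j) = w (p i))
    (hest : PatternEstimates μ m t γ s δ C dt d Jt J)
    (hlast : ∀ j, ∀ U ∈ J j, ∀ z : MarkovShift A, cyl (dt (j + 1)) z ⊆ U →
      shiftRatio m (d j) (cyl (dt (j + 1)) z) U ≤
        δ * (Real.exp (-γ (j + 1)) / s (d (j + 1)) ^ 2 *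
          shiftRatio μ (d j) (cyl (dt (j + 1)) z) U) ^ t)
    {𝒰 : Set (Set (MarkovShift A))} (h𝒰 : 𝒰 ⊆ cylinders A) {j : ℕ} {U : Set (MarkovShift A)}
    (hU : U ∈ J j) (hU𝒰 : ∀ F ∈ 𝒰, ¬ U ⊆ F)
    (hlt : ∑' F : {F // F ∈ 𝒰 ∧ F ⊆ U}, μ F.1 ^ t <
      ENNReal.ofReal (1 / C * (μ.real U / s (d j)) ^ t)) :
    ∃ T ∈ J (j + 1), T ⊆ U ∧ (∀ F ∈ 𝒰, ¬ T ⊆ F) ∧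
      ∑' F : {F // F ∈ 𝒰 ∧ F ⊆ T}, μ F.1 ^ t <
        ENNReal.ofReal (1 / C * (μ.real T / s (d (j + 1))) ^ t) := by
  have hC0 : 0 < C := zero_lt_one.trans_le hC
  have hex : ∀ v : {V : Set (MarkovShift A) // V ∈ Jt (j + 1) ∧ V ⊆ U},
      ∃ T, T ∈ J (j + 1) ∧ T ⊆ v.1 := fun v => (hpat.unique (j + 1) v.1 v.2.1).exists
  choose T hTJ hTv using hex
  obtain ⟨x, hx⟩ := hpat.isCyl j U hU
  have hlt' := hpat.lt j
  have hle' := hpat.le j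
  have hs1 := hs.one_le (d j)
  have hs2 := hs.one_le (d (j + 1))
  have mU : 0 < m.real (shift^[d j] '' U) := by
    rw [hx]; exact shift_image_cyl_pos hm le_rfl x
  have hTne : ∀ v, (T v).Nonempty := fun v => by
    obtain ⟨y, hy⟩ := hpat.isCyl _ _ (hTJ v)
    rw [hy]; exact ⟨y, mem_cyl_self _ y⟩
  have hVmeet : ∀ v v' : {V : Set (MarkovShift A) // V ∈ Jt (j + 1) ∧ V ⊆ U},
      (v.1 ∩ v'.1).Nonempty → v = v' := by
    rintro ⟨V, hV, hVU⟩ ⟨V', hV', hVU'⟩ ⟨y, hy, hy'⟩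
    refine Subtype.ext ?_
    obtain ⟨b, rfl⟩ := hpat.isCyl_tilde _ V hV
    obtain ⟨b', rfl⟩ := hpat.isCyl_tilde _ V' hV'
    change cyl _ b = cyl _ b'
    rw [← cyl_eq_of_mem hy, cyl_eq_of_mem hy']
  set k : ℝ := 1 / C * (μ.real U / s (d j)) ^ t / (δ * m.real (shift^[d j] '' U)) with hk
  have hk0 : 0 ≤ k := by positivity
  -- The weight of `U`, times `1 / C`, is distributed over the children in proportion to m-mass. By
  -- the mass estimate the shares add up to at least the total; by `child_weight_le` no share
  -- exceeds the child's own quantity.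
  let q : {V : Set (MarkovShift A) // V ∈ Jt (j + 1) ∧ V ⊆ U} → ℝ≥0∞ :=
    fun v => ENNReal.ofReal k * m (shift^[d j] '' v.1)
  have hqT : ∀ v, q v ≤ ENNReal.ofReal (1 / C * (μ.real (T v) / s (d (j + 1))) ^ t) := by
    intro v
    have h1 := child_weight_le hμ hm hs ht hδ hpat hstart hest.lower hlast hU v.2.1 (hTJ v) v.2.2
      (hTv v)
    simp only [q]
    rw [← ofReal_measureReal, ← ENNReal.ofReal_mul hk0]
    refine ENNReal.ofReal_le_ofReal ?_
    calc k * m.real (shift^[d j] '' v.1) = 1 / C * ((μ.real U / s (d j)) ^ t /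
          (δ * m.real (shift^[d j] '' U)) * m.real (shift^[d j] '' v.1)) := by rw [hk]; ring
      _ ≤ _ := by gcongr
  have hqsum : ENNReal.ofReal (1 / C * (μ.real U / s (d j)) ^ t) ≤ ∑' v, q v := by
    simp only [q]
    rw [ENNReal.tsum_mul_left]
    refine le_trans (le_of_eq ?_) (mul_le_mul_right (hest.mass j U hU) _)
    rw [← ofReal_measureReal, ← ENNReal.ofReal_mul hδ.le, ← ENNReal.ofReal_mul hk0, hk,
      div_mul_cancel₀ _ (by positivity)]
  have key : ∃ v, (∀ F ∈ 𝒰, ¬ T v ⊆ F) ∧ ∑' F : {F // F ∈ 𝒰 ∧ F ⊆ T v}, μ F.1 ^ t < q v := ?_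
  · obtain ⟨v, hv1, hv2⟩ := key
    exact ⟨T v, hTJ v, (hTv v).trans v.2.2, hv1, hv2.trans_le (hqT v)⟩
  refine exists_uncovered_child (ψ := fun F => μ F ^ t) (𝒰 := 𝒰) (U := U)
    (T := T) (q := q) (hlt.trans_le hqsum) (fun v => (hTv v).trans v.2.2) hTne
    (fun v v' h => hVmeet v v' (h.mono (inter_subset_inter (hTv v) (hTv v')))) ?_ ?_ ?_
  · intro F hF
    obtain ⟨n, y, rfl⟩ := h𝒰 hF
    exact ⟨y, mem_cyl_self n y⟩
  · intro v F hF hTF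
    obtain ⟨n, y, rfl⟩ := h𝒰 hF
    obtain ⟨b, hb⟩ := hTne v
    have hbU : b ∈ cyl (d j) x := hx ▸ v.2.2 (hTv v hb)
    rcases le_total n (d j) with h | h
    · exact absurd (hx ▸ cyl_subset_of_mem h hbU (hTF hb)) (hU𝒰 _ hF)
    · rw [hx]; exact cyl_subset_of_mem h (hTF hb) hbU
  · intro F hF hFU
    obtain ⟨n, y, rfl⟩ := h𝒰 hF
    have hyU : y ∈ cyl (d j) x := hx ▸ hFU (mem_cyl_self n y)
    have hn : d j < n := by
      by_contra! h
      exact hU𝒰 _ hF (hx ▸ cyl_subset_of_mem h hyU (mem_cyl_self n y))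
    -- A shallower `F` holds the images of many `V`, disjoint in its own image. An `F` of depth at
    -- least `dt (j + 1)` contains at most one `T`, and then `μ T ≤ μ F` suffices.
    rcases lt_or_ge n (dt (j + 1)) with hn' | hn'
    · have h1 := intermediate_weight_le hμ hm hs ht hδ hC0 hpat hstart hest hU hFU hn hn'
      calc ∑' v : {v // T v ⊆ cyl n y}, q v.1
          = ENNReal.ofReal k * ∑' v : {v // T v ⊆ cyl n y}, m (shift^[d j] '' v.1.1) :=
            ENNReal.tsum_mul_left
        _ ≤ ENNReal.ofReal k * m (shift^[d j] '' cyl n y) := by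
            gcongr
            refine tsum_measure_shift_image_le (n := dt (j + 1)) (n' := d j) hlt'.le
              (V := fun v : {v // T v ⊆ cyl n y} => v.1.1)
              (fun v => hpat.isCyl_tilde _ _ v.1.2.1)
              (fun v v' h => Subtype.ext (Subtype.ext h)) ⟨x, hx⟩ (by omega) (fun v => ?_) hFU
            obtain ⟨b, hb⟩ := hTne v.1
            obtain ⟨b', hb'⟩ := hpat.isCyl_tilde _ _ v.1.2.1
            have hb2 := hTv v.1 hb
            rw [hb'] at hb2
            change v.1.1 ⊆ _
            rw [hb']
            exact cyl_subset_of_mem hn'.le hb2 (v.2 hb)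
        _ ≤ μ (cyl n y) ^ t := by
            rw [← ofReal_measureReal, ← ENNReal.ofReal_mul hk0, ← ofReal_measureReal,
              ENNReal.ofReal_rpow_of_nonneg measureReal_nonneg ht.le]
            exact ENNReal.ofReal_le_ofReal h1
    · have hsub : ∀ v v' : {v // T v ⊆ cyl n y}, v = v' := by
        have key : ∀ v : {v // T v ⊆ cyl n y}, y ∈ v.1.1 := by
          intro v
          obtain ⟨b, hb⟩ := hTne v.1
          obtain ⟨b', hb'⟩ := hpat.isCyl_tilde _ _ v.1.2.1
          have hb2 := hTv v.1 hb
          rw [hb'] at hb2 ⊢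
          exact cyl_subset_of_mem hn' (v.2 hb) hb2 (mem_cyl_self n y)
        exact fun v v' => Subtype.ext (hVmeet _ _ ⟨y, key v, key v'⟩)
      by_cases hne : Nonempty {v // T v ⊆ cyl n y}
      · obtain ⟨v⟩ := hne
        rw [tsum_eq_single v fun v' h => absurd (hsub v' v) h]
        refine (hqT v.1).trans ?_
        refine le_trans ?_ (ENNReal.rpow_le_rpow (measure_mono v.2) ht.le)
        rw [← ofReal_measureReal, ENNReal.ofReal_rpow_of_nonneg measureReal_nonneg ht.le]
        refine ENNReal.ofReal_le_ofReal ?_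
        calc 1 / C * (μ.real (T v.1) / s (d (j + 1))) ^ t
            ≤ 1 * (μ.real (T v.1) / s (d (j + 1))) ^ t := by
              gcongr
              rw [div_le_one hC0]; exact hC
          _ ≤ μ.real (T v.1) ^ t := by
              rw [one_mul]
              gcongr
              exact div_le_self measureReal_nonneg hs2
      · rw [not_nonempty_iff] at hne
        simp

/-- The mass distribution principle for a pattern. -/
theorem le_dimMu_patternSet [IsProbabilityMeasure μ] [IsFiniteMeasure m]
    (hμ : ∀ n (x : MarkovShift A), 0 < μ.real (cyl n x))
    (hm : ∀ n (x : MarkovShift A), 0 < m.real (cyl n x))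
    (hs : IsDistortionSeq μ a w p s) (ht : 0 < t) (hδ : 0 < δ) (hC : 1 ≤ C)
    (hpat : IsPattern dt d Jt J J0)
    (hstart : ∀ j, ∀ U ∈ J j, ∀ z ∈ U, z 0 = a ∧ ∃ i, z (d j) = w (p i))
    (hest : PatternEstimates μ m t γ s δ C dt d Jt J)
    (hlast : ∀ j, ∀ U ∈ J j, ∀ z : MarkovShift A, cyl (dt (j + 1)) z ⊆ U →
      shiftRatio m (d j) (cyl (dt (j + 1)) z) U ≤
        δ * (Real.exp (-γ (j + 1)) / s (d (j + 1)) ^ 2 *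
          shiftRatio μ (d j) (cyl (dt (j + 1)) z) U) ^ t) :
    ENNReal.ofReal t ≤ dimMu μ (patternSet J) := by
  have hC0 : 0 < C := zero_lt_one.trans_le hC
  have hJ0 : J0 ∈ J 0 := by rw [hpat.zero]; rfl
  obtain ⟨x, hx⟩ := hpat.isCyl 0 J0 hJ0
  have hs0 := hs.one_le (d 0)
  have hpos : 0 < μ.real J0 := by rw [hx]; exact hμ _ _
  refine le_caratheodoryDim (fun B _ => prob_le_one)
    (κ := ENNReal.ofReal (1 / C * (μ.real J0 / s (d 0)) ^ t))
    (ENNReal.ofReal_pos.2 (by positivity)) fun 𝒰 h𝒰 hcov => ?_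
  by_contra! hlt
  let Good : ℕ → Set (MarkovShift A) → Prop := fun j U => U ∈ J j ∧ (∀ F ∈ 𝒰, ¬ U ⊆ F) ∧
      ∑' F : {F // F ∈ 𝒰 ∧ F ⊆ U}, μ F.1 ^ t <
        ENNReal.ofReal (1 / C * (μ.real U / s (d j)) ^ t)
  have h0 : Good 0 J0 := by
    refine ⟨hJ0, fun F hF hJF => ?_, lt_of_le_of_lt ?_ hlt⟩
    · refine hlt.not_ge (le_trans ?_ (ENNReal.le_tsum (⟨F, hF⟩ : 𝒰)))
      refine le_trans ?_ (ENNReal.rpow_le_rpow (measure_mono hJF) ht.le)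
      rw [← ofReal_measureReal, ENNReal.ofReal_rpow_of_nonneg measureReal_nonneg ht.le]
      refine ENNReal.ofReal_le_ofReal ?_
      calc 1 / C * (μ.real J0 / s (d 0)) ^ t ≤ 1 * (μ.real J0 / s (d 0)) ^ t := by
            gcongr
            rw [div_le_one hC0]; exact hC
        _ ≤ μ.real J0 ^ t := by
            rw [one_mul]
            gcongr
            exact div_le_self measureReal_nonneg hs0
    · let e : {F // F ∈ 𝒰 ∧ F ⊆ J0} → 𝒰 := fun F => ⟨F.1, F.2.1⟩
      have he : Function.Injective e := fun F G h =>
        Subtype.ext (congrArg (fun H : 𝒰 => H.1) h)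
      exact ENNReal.tsum_comp_le_tsum_of_injective he fun F => μ F.1 ^ t
  have hstep : ∀ j, ∀ U : {U // Good j U}, ∃ T : {T // Good (j + 1) T}, T.1 ⊆ U.1 := by
    rintro j ⟨U, hU, hU1, hU2⟩
    obtain ⟨T, hT, hTU, hT1, hT2⟩ := exists_uncovered_pattern_child hμ hm hs ht hδ hC hpat hstart
      hest hlast h𝒰 hU hU1 hU2
    exact ⟨⟨T, hT, hT1, hT2⟩, hTU⟩
  choose f hf using hstep
  let V : ∀ j, {U // Good j U} := fun j => Nat.rec ⟨J0, h0⟩ (fun j U => f j U) j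
  obtain ⟨z, hz⟩ := exists_mem_of_antitone hpat.strictMono (U := fun j => (V j).1)
    (fun j => hpat.isCyl j _ (V j).2.1) (antitone_nat_of_succ_le fun j => hf j (V j))
  obtain ⟨F, hF, hzF⟩ := hcov (mem_iInter.2 fun j => ⟨_, (V j).2.1, hz j⟩ : z ∈ patternSet J)
  obtain ⟨n, y, rfl⟩ := h𝒰 hF
  obtain ⟨b, hb⟩ := hpat.isCyl n _ (V n).2.1
  -- The covering cylinder has some depth `n`, and `d n ≥ n`: the `n`-th set of the descent lies in
  -- it, which the descent forbids.
  refine (V n).2.2.1 _ hF ?_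
  have hzn := hz n
  simp only [hb] at hzn ⊢
  exact cyl_subset_of_mem hpat.strictMono.le_apply hzn hzF

end MarkovShift

/-! ### The pattern of orbits visiting the target at prescribed times. -/

namespace MarkovShift

variable {I : Type*} {A : I → I → Prop}

/-- The points of `cyl (d 0) x` which at the times `dt 1, …, dt j` enter the cylinders
`cyl (q 1) w, …, cyl (q j) w`. -/
def visitSet (x w : MarkovShift A) (dt d q : ℕ → ℕ) (j : ℕ) : Set (MarkovShift A) :=
  {z | z ∈ cyl (d 0) x ∧ ∀ i < j, shift^[dt (i + 1)] z ∈ cyl (q (i + 1)) w}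

/-- The `d j`-cylinders of the pattern of visits. -/
def visitCyl (x w : MarkovShift A) (dt d q : ℕ → ℕ) (j : ℕ) : Set (Set (MarkovShift A)) :=
  {U | ∃ z ∈ visitSet x w dt d q j, U = cyl (d j) z}

/-- The `dt j`-cylinders of the pattern of visits. -/
def visitCylTilde (x w : MarkovShift A) (dt d q : ℕ → ℕ) : ℕ → Set (Set (MarkovShift A))
  | 0 => {cyl (d 0) x}
  | j + 1 => {V | ∃ z ∈ visitSet x w dt d q j, z (dt (j + 1)) = w 0 ∧ V = cyl (dt (j + 1)) z}

section Visit

variable {x w : MarkovShift A} {dt d q : ℕ → ℕ}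

theorem visitSet_of_mem_cyl (h0 : ∀ i, dt i + q i = d i ∨ i = 0) (hd : StrictMono d) {j : ℕ}
    {y z : MarkovShift A} (hz : z ∈ visitSet x w dt d q j) (hy : y ∈ cyl (d j) z) :
    y ∈ visitSet x w dt d q j := by
  refine ⟨fun k hk => (hy k (hk.trans (hd.monotone (Nat.zero_le j)))).trans (hz.1 k hk),
    fun i hi k hk => ?_⟩
  rw [← hz.2 i hi k hk, shift_iterate_apply, shift_iterate_apply]
  refine hy _ ?_
  have h1 := (h0 (i + 1)).resolve_right (Nat.succ_ne_zero i)
  have h2 := hd.monotone (show i + 1 ≤ j from hi)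
  omega

theorem visitSet_succ_subset (j : ℕ) : visitSet x w dt d q (j + 1) ⊆ visitSet x w dt d q j :=
  fun _ hz => ⟨hz.1, fun i hi => hz.2 i (hi.trans (Nat.lt_succ_self j))⟩

/-- A `dt`-cylinder ending in `w 0` can be continued by `w`, and the continuation is forced up to
depth `d`; hence exactly one `d`-cylinder inside it. -/
theorem isPattern_visitCyl (h00 : dt 0 = d 0) (hlt : ∀ j, d j < dt (j + 1))
    (hq : ∀ j, d (j + 1) = dt (j + 1) + q (j + 1)) :
    IsPattern dt d (visitCylTilde x w dt d q) (visitCyl x w dt d q) (cyl (d 0) x) := by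
  have h0 : ∀ i, dt i + q i = d i ∨ i = 0 := by
    rintro (_ | i)
    · exact Or.inr rfl
    · exact Or.inl (hq i).symm
  have hle : ∀ j, dt (j + 1) ≤ d (j + 1) := fun j => by rw [hq]; omega
  have hd : StrictMono d := strictMono_nat_of_lt_succ fun j => (hlt j).trans_le (hle j)
  have hzero : visitCyl x w dt d q 0 = {cyl (d 0) x} := by
    ext U
    constructor
    · rintro ⟨z, hz, rfl⟩
      exact cyl_eq_of_mem hz.1
    · rintro rfl
      exact ⟨x, ⟨mem_cyl_self _ _, fun i hi => absurd hi (Nat.not_lt_zero i)⟩, rfl⟩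
  refine ⟨?_, ?_, rfl, hzero, h00, hlt, hle, ?_, ?_, ?_⟩
  · rintro (_ | j) U hU
    · exact ⟨x, hU.trans (by rw [h00])⟩
    · obtain ⟨z, -, -, rfl⟩ := hU
      exact ⟨z, rfl⟩
  · rintro j U ⟨z, -, rfl⟩
    exact ⟨z, rfl⟩
  · rintro j U ⟨z, hz, rfl⟩
    refine ⟨_, ⟨z, visitSet_succ_subset j hz, ?_, rfl⟩, cyl_anti (hle j) z⟩
    have := hz.2 j (Nat.lt_succ_self j) 0 (Nat.zero_le _)
    rwa [shift_iterate_apply, Nat.add_zero] at this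
  · rintro j V ⟨z, hz, -, rfl⟩
    exact ⟨_, ⟨z, hz, rfl⟩, cyl_anti (hlt j).le z⟩
  · rintro (_ | j) V hV
    · obtain rfl : V = cyl (d 0) x := hV
      rw [hzero]
      exact ⟨_, ⟨rfl, Subset.rfl⟩, fun U hU => hU.1⟩
    · obtain ⟨z, hz, hzw, rfl⟩ := hV
      obtain ⟨y, hy, hyw⟩ := exists_splice hzw
      have hyj : y ∈ visitSet x w dt d q j :=
        visitSet_of_mem_cyl h0 hd hz (cyl_anti (hlt j).le z hy)
      have hyj1 : y ∈ visitSet x w dt d q (j + 1) := by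
        refine ⟨hyj.1, fun i hi => ?_⟩
        rcases Nat.lt_succ_iff_lt_or_eq.1 hi with h | rfl
        · exact hyj.2 i h
        · rw [hyw]; exact mem_cyl_self _ _
      refine ⟨_, ⟨⟨y, hyj1, rfl⟩, ?_⟩, ?_⟩
      · rw [← cyl_eq_of_mem hy]; exact cyl_anti (hle j) y
      · rintro U ⟨⟨z', hz', rfl⟩, hsub⟩
        refine (cyl_eq_of_mem fun k hk => ?_)
        -- Letters up to `dt (j + 1)` are fixed by the enclosing cylinder, later ones by the visit
        -- to `w`.
        rcases le_total k (dt (j + 1)) with h | h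
        · exact (hsub (mem_cyl_self _ _) k h).trans (hy k h).symm
        · have h1 := hz'.2 j (Nat.lt_succ_self j) (k - dt (j + 1))
            (by have := hq j; omega)
          have h2 := shift_iterate_apply (dt (j + 1)) y (k - dt (j + 1))
          rw [shift_iterate_apply] at h1
          rw [hyw] at h2
          rw [show dt (j + 1) + (k - dt (j + 1)) = k by omega] at h1 h2
          exact h1.trans h2

theorem mem_visitSet_of_mem_visitCyl (hlt : ∀ j, d j < dt (j + 1))
    (hq : ∀ j, d (j + 1) = dt (j + 1) + q (j + 1)) {j : ℕ} {U : Set (MarkovShift A)}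
    (hU : U ∈ visitCyl x w dt d q j) {z : MarkovShift A} (hz : z ∈ U) :
    z ∈ visitSet x w dt d q j ∧ U = cyl (d j) z := by
  obtain ⟨y, hy, rfl⟩ := hU
  refine ⟨visitSet_of_mem_cyl ?_ ?_ hy hz, (cyl_eq_of_mem hz).symm⟩
  · rintro (_ | i)
    · exact Or.inr rfl
    · exact Or.inl (hq i).symm
  · exact strictMono_nat_of_lt_succ fun j => by have := hq j; have := hlt j; omega

/-- The left side is the set of returns to `w 0` after `dt (j + 1) - d j` steps; it is covered by
the images of the children, and its mass is controlled by mixing. -/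
theorem visit_mass_le [Countable I] {m : Measure (MarkovShift A)} {j : ℕ}
    (hlt : d j < dt (j + 1)) {U : Set (MarkovShift A)} {y : MarkovShift A}
    (hU : U = cyl (d j) y)
    (hvis : ∀ z ∈ U, z ∈ visitSet x w dt d q j) :
    m (cyl 0 (shift^[d j] y) ∩ shift^[dt (j + 1) - d j] ⁻¹' cyl 0 w) ≤
      ∑' V : {V : Set (MarkovShift A) // V ∈ visitCylTilde x w dt d q (j + 1) ∧ V ⊆ U},
        m (shift^[d j] '' V.1) := by
  have hc : Countable
      {V : Set (MarkovShift A) // V ∈ visitCylTilde x w dt d q (j + 1) ∧ V ⊆ U} := by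
    refine (countable_cylinders.mono ?_).to_subtype
    rintro V ⟨⟨z, -, -, rfl⟩, -⟩
    exact ⟨_, z, rfl⟩
  refine (measure_mono ?_).trans (measure_iUnion_le _)
  rintro v ⟨hv1, hv2⟩
  have : v ∈ shift^[d j] '' cyl (d j) y := by rwa [shift_image_cyl le_rfl, Nat.sub_self]
  obtain ⟨z, hz, rfl⟩ := this
  have hzw := hv2 0 le_rfl
  rw [← Function.iterate_add_apply, Nat.sub_add_cancel hlt.le, shift_iterate_apply,
    Nat.add_zero] at hzw
  refine mem_iUnion.2 ⟨⟨cyl (dt (j + 1)) z, ⟨z, hvis z (hU ▸ hz), hzw, rfl⟩, ?_⟩,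
    z, mem_cyl_self _ _, rfl⟩
  rw [hU, ← cyl_eq_of_mem hz]
  exact cyl_anti hlt.le z

end Visit

end MarkovShift

/-! ### Subexponential errors and Gibbs estimates for conditional masses. -/

theorem eventually_const_add_le {f : ℕ → ℝ} (hf : Tendsto (fun n : ℕ => f n / n) atTop (𝓝 0))
    (c : ℝ) {ε : ℝ} (hε : 0 < ε) : ∀ᶠ n : ℕ in atTop, c + f n ≤ ε * n := by
  have h := ((tendsto_const_div_atTop_nhds_zero_nat c).add hf).eventually
    (gt_mem_nhds (show (0 : ℝ) + 0 < ε by linarith))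
  filter_upwards [h, eventually_gt_atTop 0] with n hn h0
  rw [← add_div, div_lt_iff₀ (by exact_mod_cast h0)] at hn
  exact hn.le

theorem tendsto_comp_add_div {f : ℕ → ℝ} (hf : Tendsto (fun n : ℕ => f n / n) atTop (𝓝 0))
    (k : ℕ) : Tendsto (fun n : ℕ => f (n + k) / n) atTop (𝓝 0) := by
  have h1 : Tendsto (fun n : ℕ => 1 + (k : ℝ) / n) atTop (𝓝 (1 + 0)) :=
    tendsto_const_nhds.add (tendsto_const_div_atTop_nhds_zero_nat _)
  have h2 := ((tendsto_add_atTop_iff_nat k).2 hf).mul h1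
  rw [zero_mul] at h2
  refine h2.congr' ?_
  filter_upwards [eventually_gt_atTop 0] with n hn
  have : (0 : ℝ) < n := by exact_mod_cast hn
  push_cast
  field_simp

/-- A bound for a subexponential factor times a decaying exponential. -/
theorem exists_le_of_tendsto_div {f : ℕ → ℝ} (hf : Tendsto (fun n : ℕ => f n / n) atTop (𝓝 0))
    {ε : ℝ} (hε : 0 < ε) : ∃ B, 0 ≤ B ∧ ∀ n : ℕ, f n - ε * n ≤ B := by
  obtain ⟨n0, hn0⟩ := eventually_atTop.1 (eventually_const_add_le hf 0 hε)
  refine ⟨∑ i ∈ Finset.range n0, |f i - ε * i|, Finset.sum_nonneg fun _ _ => abs_nonneg _,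
    fun n => ?_⟩
  rcases lt_or_ge n n0 with h | h
  · exact (le_abs_self _).trans (Finset.single_le_sum (f := fun i : ℕ => |f i - ε * i|)
      (fun _ _ => abs_nonneg _) (Finset.mem_range.2 h))
  · have h1 := hn0 n h
    have h2 : 0 ≤ ∑ i ∈ Finset.range n0, |f i - ε * i| :=
      Finset.sum_nonneg fun _ _ => abs_nonneg _
    linarith

namespace MarkovShift

variable {I : Type*} {A : I → I → Prop} {μ m : Measure (MarkovShift A)}
  {φ : MarkovShift A → ℝ} {P P' : ℝ} {K K' : ℕ → ℝ} {c c' : I → ℝ}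

theorem div_eq_exp_sub_log {x y : ℝ} (hx : 0 < x) (hy : 0 < y) :
    x / y = Real.exp (Real.log x - Real.log y) := by
  rw [Real.exp_sub, Real.exp_log hx, Real.exp_log hy]

theorem shiftRatio_cyl (μ : Measure (MarkovShift A)) {d n : ℕ} (h : d ≤ n)
    (z : MarkovShift A) : shiftRatio μ d (cyl n z) (cyl d z) =
      μ.real (cyl (n - d) (shift^[d] z)) / μ.real (cyl 0 (shift^[d] z)) := by
  rw [shiftRatio, shift_image_cyl h, shift_image_cyl le_rfl, Nat.sub_self]

namespace IsLocalWeakGibbs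

/-- Conditional masses of cylinders are the same up to the Gibbs constants whichever prefix of
length `n` one forgets. -/
theorem abs_log_ratio_sub_le (h : IsLocalWeakGibbs μ φ P K c) (hφ : Continuous φ) (n i : ℕ)
    (x : MarkovShift A) :
    |(Real.log (μ.real (cyl (n + i) x)) - Real.log (μ.real (cyl n x))) -
      (Real.log (μ.real (cyl i (shift^[n] x))) - Real.log (μ.real (cyl 0 (shift^[n] x))))| ≤
      2 * Real.log (c (x 0)) + 2 * Real.log (c (x n)) + Real.log (K (n + i + 1)) +
        Real.log (K (n + 1)) + Real.log (K (i + 1)) + Real.log (K 1) := by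
  have h1 := abs_le.1 (h.abs_log_sub_le hφ (n + i) x)
  have h2 := abs_le.1 (h.abs_log_sub_le hφ n x)
  have h3 := abs_le.1 (h.abs_log_sub_le hφ i (shift^[n] x))
  have h4 := abs_le.1 (h.abs_log_sub_le hφ 0 (shift^[n] x))
  rw [shift_iterate_apply, Nat.add_zero] at h3 h4
  have e1 := birkhoffSum_add shift φ n (i + 1) x
  have e2 := birkhoffSum_add shift φ n 1 x
  rw [← add_assoc] at e1
  rw [e1] at h1
  rw [e2] at h2
  push_cast at h1 h2 h3 h4
  rw [abs_le]
  constructor <;> linarith [h1.1, h1.2, h2.1, h2.2, h3.1, h3.2, h4.1, h4.2]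

theorem abs_log_pred_ratio_le (h : IsLocalWeakGibbs μ φ P K c) (hφ : Continuous φ) (n : ℕ)
    (x : MarkovShift A) :
    |(Real.log (μ.real (cyl n x)) - Real.log (μ.real (cyl (n + 1) x))) +
      Real.log (μ.real (cyl 0 (shift^[n + 1] x)))| ≤
      2 * Real.log (c (x 0)) + Real.log (c (x (n + 1))) + Real.log (K (n + 1)) +
        Real.log (K (n + 2)) + Real.log (K 1) := by
  have h1 := abs_le.1 (h.abs_log_sub_le hφ n x)
  have h2 := abs_le.1 (h.abs_log_sub_le hφ (n + 1) x)
  have h3 := abs_le.1 (h.abs_log_sub_le hφ 0 (shift^[n + 1] x))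
  rw [shift_iterate_apply, Nat.add_zero] at h3
  have e1 := birkhoffSum_add shift φ (n + 1) 1 x
  rw [e1] at h2
  push_cast at h1 h2 h3
  rw [abs_le]
  constructor <;> linarith [h1.1, h1.2, h2.1, h2.2, h3.1, h3.2]

/-- The four `L` terms absorb the values of `log K` in `abs_log_ratio_sub_le`. The shift by 2 is
needed for `K (n + 2)` in the comparison with the predecessor cylinder. -/
theorem isDistortionSeq (h : IsLocalWeakGibbs μ φ P K c) (hφ : Continuous φ) {w : MarkovShift A}
    {p : ℕ → ℕ} {b : ℝ} (hb : ∀ j, Real.log (c (w (p j))) ≤ b) (u0 : I) {L : ℕ → ℝ}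
    (hL0 : ∀ n, 0 ≤ L n) (hLmono : Monotone L) (hLK : ∀ n, 1 ≤ n → Real.log (K n) ≤ L n)
    (hLdiv : Tendsto (fun n : ℕ => L n / n) atTop (𝓝 0)) :
    IsDistortionSeq μ u0 w p
      (fun n => Real.exp (2 * Real.log (c u0) + 2 * b + 4 * L (n + 2))) := by
  have ha := h.log_c_nonneg u0
  have hb0 : 0 ≤ b := (h.log_c_nonneg (w (p 0))).trans (hb 0)
  refine ⟨fun n => Real.one_le_exp ?_, fun i j hij => ?_, ?_, ?_, ?_⟩
  · linarith [hL0 (n + 2)]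
  · refine Real.exp_le_exp.2 ?_
    linarith [hLmono (show i + 2 ≤ j + 2 by omega)]
  · have h1 := (tendsto_const_div_atTop_nhds_zero_nat (2 * Real.log (c u0) + 2 * b)).add
      ((tendsto_comp_add_div hLdiv 2).const_mul 4)
    rw [mul_zero, add_zero] at h1
    refine h1.congr fun n => ?_
    rw [Real.log_exp]
    ring
  · intro z n j hz0 hzn m hm
    obtain ⟨k, rfl⟩ := Nat.exists_eq_add_of_lt hm
    have h1 := abs_le.1 (h.abs_log_ratio_sub_le hφ n (k + 1) z)
    have hbj := hb j
    rw [hz0, hzn] at h1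
    have k1 := (hLK (n + k + 1 + 1) (by omega)).trans
      (hLmono (show n + k + 1 + 1 ≤ n + k + 1 + 2 by omega))
    have k2 := (hLK (n + 1) (by omega)).trans
      (hLmono (show n + 1 ≤ n + k + 1 + 2 by omega))
    have k3 := (hLK (k + 1 + 1) (by omega)).trans
      (hLmono (show k + 1 + 1 ≤ n + k + 1 + 2 by omega))
    have k4 := (hLK 1 le_rfl).trans
      (hLmono (show 1 ≤ n + k + 1 + 2 by omega))
    rw [shiftRatio_cyl μ (by omega), show n + k + 1 - n = k + 1 by omega,
      div_eq_exp_sub_log (h.real_pos _ _) (h.real_pos _ _),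
      div_eq_exp_sub_log (h.real_pos _ _) (h.real_pos _ _), one_div, ← Real.exp_neg,
      ← Real.exp_add, ← Real.exp_add, Real.exp_le_exp, Real.exp_le_exp]
    rw [← add_assoc] at h1
    constructor <;> linarith [h1.1, h1.2]
  · intro z n j hz0 hzn
    have h1 := abs_le.1 (h.abs_log_pred_ratio_le hφ n z)
    have hbj := hb j
    rw [hz0, hzn] at h1
    have k1 := (hLK (n + 1) (by omega)).trans (hLmono (show n + 1 ≤ n + 2 by omega))
    have k2 := hLK (n + 2) (by omega)
    have k3 := (hLK 1 le_rfl).trans (hLmono (show 1 ≤ n + 2 by omega))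
    have k4 := hL0 (n + 2)
    rw [shift_image_cyl le_rfl, Nat.sub_self, one_div (μ.real _), one_div (Real.exp _),
      ← Real.exp_log (h.real_pos 0 (shift^[n + 1] z)), ← Real.exp_neg, ← Real.exp_neg,
      div_eq_exp_sub_log (h.real_pos _ _) (h.real_pos _ _),
      ← Real.exp_add, ← Real.exp_add, Real.exp_le_exp, Real.exp_le_exp]
    constructor <;> linarith [h1.1, h1.2]

/-- Comparison of the conditional masses of a cylinder for Gibbs measures of `tφ` and of `φ`. -/
theorem log_ratio_le (h : IsLocalWeakGibbs μ φ P K c) (hφ : Continuous φ) {t : ℝ} (ht : 0 ≤ t)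
    (hm : IsLocalWeakGibbs m (fun x => t * φ x) P' K' c') (r : ℕ) (y : MarkovShift A) :
    Real.log (m.real (cyl r y)) - Real.log (m.real (cyl 0 y)) ≤
      t * (Real.log (μ.real (cyl r y)) - Real.log (μ.real (cyl 0 y))) - r * (P' - t * P) +
        (2 * Real.log (c' (y 0)) + 2 * Real.log (K' (r + 1)) +
          t * (2 * Real.log (c (y 0)) + 2 * Real.log (K (r + 1)))) := by
  have h1 := abs_le.1 (h.abs_log_sub_le hφ r y)
  have h2 := abs_le.1 (h.abs_log_sub_le hφ 0 y)
  have h3 := abs_le.1 (hm.abs_log_sub_le (continuous_const.mul hφ) r y)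
  have h4 := abs_le.1 (hm.abs_log_sub_le (continuous_const.mul hφ) 0 y)
  have hb : ∀ n, birkhoffSum shift (fun x => t * φ x) n y = t * birkhoffSum shift φ n y := by
    intro n
    simp [birkhoffSum, Finset.mul_sum]
  have k1 := h.log_K_mono (show 0 + 1 ≤ r + 1 by omega)
  have k2 := hm.log_K_mono (show 0 + 1 ≤ r + 1 by omega)
  simp only at k1 k2
  rw [hb] at h3 h4
  push_cast at h1 h2 h3 h4
  have m1 := mul_le_mul_of_nonneg_left h1.1 ht
  have m2 := mul_le_mul_of_nonneg_left h2.2 ht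
  have m3 := mul_le_mul_of_nonneg_left k1 ht
  ring_nf at m1 m2 m3 h3 h4 k2 ⊢
  linarith [h3.2, h4.1]

/-- A lower bound for the conditional mass of `cyl q w` after a visit to `w 0`. -/
theorem log_visit_ratio_ge (h : IsLocalWeakGibbs μ φ P K c) (hφ : Continuous φ) (r q : ℕ)
    {y w : MarkovShift A} (hy : shift^[r] y ∈ cyl q w) :
    Real.log (μ.real (cyl q w)) - 2 * Real.log (c (y 0)) - 2 * Real.log (c (w 0)) -
        4 * Real.log (K (r + q + 1)) ≤
      Real.log (μ.real (cyl (r + q) y)) - Real.log (μ.real (cyl r y)) := by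
  have := h.prob
  have h1 := (abs_le.1 (h.abs_log_ratio_sub_le hφ r q y)).1
  have hw : y r = w 0 := by
    have := hy 0 (Nat.zero_le _)
    rwa [shift_iterate_apply, Nat.add_zero] at this
  rw [cyl_eq_of_mem hy, hw] at h1
  have h0 : Real.log (μ.real (cyl 0 (shift^[r] y))) ≤ 0 :=
    Real.log_nonpos measureReal_nonneg measureReal_le_one
  have k2 := h.log_K_mono (show r + 1 ≤ r + q + 1 by omega)
  have k3 := h.log_K_mono (show q + 1 ≤ r + q + 1 by omega)
  have k4 := h.log_K_mono (show 1 ≤ r + q + 1 by omega)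
  simp only at k2 k3 k4
  linarith

end IsLocalWeakGibbs

end MarkovShift

/-! ### Choice of the visit times. -/

theorem exists_times {Q : ℕ → ℕ → ℕ → ℕ → Prop} (p : ℕ → ℕ)
    (h : ∀ d i, ∃ n i', Q d i n i') (d0 : ℕ) :
    ∃ dt d idx : ℕ → ℕ, dt 0 = d0 ∧ d 0 = d0 ∧ idx 0 = 0 ∧
      ∀ j, Q (d j) (idx j) (dt (j + 1)) (idx (j + 1)) ∧
        d (j + 1) = dt (j + 1) + p (idx (j + 1)) := by
  choose f g hfg using h
  let st : ℕ → ℕ × ℕ × ℕ := fun j => Nat.rec (d0, d0, 0)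
    (fun _ x => (f x.2.1 x.2.2, f x.2.1 x.2.2 + p (g x.2.1 x.2.2), g x.2.1 x.2.2)) j
  exact ⟨fun j => (st j).1, fun j => (st j).2.1, fun j => (st j).2.2, rfl, rfl, rfl,
    fun j => ⟨hfg _ _, rfl⟩⟩

namespace MarkovShift

variable {I : Type*} {A : I → I → Prop} {μ m : Measure (MarkovShift A)}
  {φ : MarkovShift A → ℝ} {P P' : ℝ} {K K' : ℕ → ℝ} {c c' : I → ℝ}

/-- Extending the target from depth `l n` to the next hitting index `p i` costs only `η` in the
exponential rate, for infinitely many `n`. The last bound keeps the distortion at the enlarged depth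
`o(n)`; for bounded `K` it is free, because `L` is constant. -/
theorem IsLocalWeakGibbs.frequently_hitting (h : IsLocalWeakGibbs μ φ P K c)
    {w : MarkovShift A} {p l : ℕ → ℕ} (hp : StrictMono p)
    (hl : ¬ BddAbove (range K) →
      IsBoundedUnder (· ≤ ·) atTop (fun n : ℕ => (l n : ℝ) / (n : ℝ)))
    {sbar : ℝ} (hs0 : 0 ≤ sbar)
    (hsbar : limsup (fun n : ℕ =>
      ((1 / (n : ℝ) * Real.log (1 / μ.real (cyl (l n) w)) : ℝ) : EReal)) atTop = (sbar : EReal))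
    {L : ℕ → ℝ} (hL0 : ∀ n, 0 ≤ L n) (hLmono : Monotone L)
    (hLadd : ∀ a b, L (a + b) ≤ L a + L b) (hLb : BddAbove (range K) → ∀ n, L n = L 0)
    {η : ℝ} (hη : 0 < η) :
    ∃ R : ℕ, ∃ᶠ n : ℕ in atTop, ∃ i, l n ≤ p i ∧
      -Real.log (μ.real (cyl (p i) w)) ≤ (sbar + η) * n ∧ L (n + p i + 2) ≤ R * L n := by
  have := h.prob
  have hmono : Monotone fun n => -Real.log (μ.real (cyl n w)) := fun i j hij =>
    neg_le_neg (Real.log_le_log (h.real_pos _ _) (measureReal_mono (cyl_anti hij w)))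
  have hev : ∀ᶠ n : ℕ in atTop, -Real.log (μ.real (cyl (l n) w)) ≤ (sbar + η / 2) * n := by
    have h1 : limsup (fun n : ℕ =>
        ((1 / (n : ℝ) * Real.log (1 / μ.real (cyl (l n) w)) : ℝ) : EReal)) atTop <
        ((sbar + η / 2 : ℝ) : EReal) := by
      rw [hsbar]; exact_mod_cast (by linarith : sbar < sbar + η / 2)
    filter_upwards [eventually_lt_of_limsup_lt h1, eventually_gt_atTop 0] with n hn hn0
    have hn' : (0 : ℝ) < n := by exact_mod_cast hn0
    have h2 : 1 / (n : ℝ) * Real.log (1 / μ.real (cyl (l n) w)) < sbar + η / 2 := by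
      exact_mod_cast hn
    rw [one_div (μ.real _), Real.log_inv, one_div, inv_mul_lt_iff₀ hn'] at h2
    linarith
  obtain ⟨R, hR, hD⟩ : ∃ R : ℕ, 1 ≤ R ∧
      (¬ BddAbove (range K) → ∀ᶠ n in atTop, l n ≤ R * n) := by
    by_cases hb : BddAbove (range K)
    · exact ⟨1, le_rfl, fun h => absurd hb h⟩
    · obtain ⟨x, hx⟩ := hl hb
      obtain ⟨R, hR⟩ := exists_nat_ge x
      refine ⟨R + 1, by omega, fun _ => ?_⟩
      filter_upwards [eventually_map.1 hx, eventually_gt_atTop 0] with n hn hn0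
      have hn' : (0 : ℝ) < n := by exact_mod_cast hn0
      rw [div_le_iff₀ hn'] at hn
      have : (l n : ℝ) ≤ ((R + 1) * n : ℕ) := by
        push_cast
        nlinarith
      exact_mod_cast this
  -- For `n ≥ 1` and `p i ≤ 2 * R * n` one has `n + p i + 2 ≤ (2 * R + 3) * n`.
  refine ⟨2 * R + 3, ?_⟩
  refine ((frequently_exists_le_of_strictMono hmono hp (show sbar + η / 2 < sbar + η by linarith)
    (by linarith) hev hR hD).and_eventually (eventually_ge_atTop 1)).mono ?_
  rintro n ⟨⟨i, h1, h2, h3⟩, hn⟩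
  refine ⟨i, h1, h2, ?_⟩
  by_cases hb : BddAbove (range K)
  · rw [hLb hb, hLb hb n]
    have : (1 : ℝ) ≤ (2 * R + 3 : ℕ) := by push_cast; linarith [Nat.cast_nonneg (α := ℝ) R]
    exact le_mul_of_one_le_left (hL0 0) this
  · refine le_trans (hLmono ?_) (subadditive_nat_mul_le hLadd (show 1 ≤ 2 * R + 3 by omega) n)
    have := h3 hb
    nlinarith

/-- The data of the next visit of the pattern. -/
theorem exists_next_visit (hm : ∀ n (x : MarkovShift A), 0 < m (cyl n x)) [IsFiniteMeasure m]
    (hmix : IsMixing m) {w : MarkovShift A} {p l : ℕ → ℕ} {g κ κ' L : ℕ → ℝ} {R : ℕ}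
    {sbar t ε : ℝ} (ht : 0 < t) (hε : 0 < ε)
    (hfreq : ∃ᶠ n : ℕ in atTop, ∃ i, l n ≤ p i ∧ g (p i) ≤ (sbar + ε / (4 * t)) * n ∧
      L (n + p i + 2) ≤ R * L n)
    (hLmono : Monotone L) (hLκ : ∀ n, 1 ≤ n → κ n ≤ L n)
    (hLdiv : Tendsto (fun n : ℕ => L n / n) atTop (𝓝 0))
    (hκ' : Tendsto (fun n : ℕ => κ' n / n) atTop (𝓝 0)) (α α' β β' x : ℝ) (d i : ℕ) :
    ∃ n i', d < n ∧ l n ≤ p i' ∧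
      g (p i') + α + 4 * L (n + p i' + 2) ≤ n * (sbar + ε / (2 * t)) ∧
      d * x + (2 * β' + 2 * κ' (n + 1) + t * (2 * β + 2 * κ (n + 1))) +
        2 * t * (α' + 4 * L (n + p i' + 2)) -
          Real.log ((m.real (cyl 0 w)) / 2) ≤ n * (ε / 2) ∧
      ENNReal.ofReal (m.real (cyl 0 w) / 2) * m (cyl 0 (shift^[p i] w)) ≤
        m (cyl 0 (shift^[p i] w) ∩ shift^[n - d] ⁻¹' cyl 0 w) := by
  have hmass : ∀ᶠ n : ℕ in atTop,
      ENNReal.ofReal (m.real (cyl 0 w) / 2) * m (cyl 0 (shift^[p i] w)) ≤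
        m (cyl 0 (shift^[p i] w) ∩ shift^[n - d] ⁻¹' cyl 0 w) := by
    have h1 := (hmix (cyl 0 (shift^[p i] w)) (cyl 0 w) (measurableSet_cyl _ _)
      (measurableSet_cyl _ _)).comp (tendsto_sub_atTop_nat d)
    have h2 : ENNReal.ofReal (m.real (cyl 0 w) / 2) * m (cyl 0 (shift^[p i] w)) <
        m (cyl 0 (shift^[p i] w)) * m (cyl 0 w) := by
      rw [mul_comm]
      refine ENNReal.mul_lt_mul_right (hm _ _).ne' (measure_ne_top _ _) ?_
      rw [← ofReal_measureReal (s := cyl 0 w)]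
      have : 0 < m.real (cyl 0 w) := ENNReal.toReal_pos (hm 0 w).ne' (measure_ne_top _ _)
      exact (ENNReal.ofReal_lt_ofReal_iff this).2 (half_lt_self this)
    exact (h1.eventually (lt_mem_nhds h2)).mono fun n hn => hn.le
  -- Of the allowance `ε / (2 * t)` in `γ`, the rate of `g` uses one half and the errors use the
  -- other.
  have hA := eventually_const_add_le (f := fun n => 4 * (R * L n))
    (by simpa [mul_div_assoc] using (hLdiv.const_mul (R : ℝ)).const_mul 4) α
    (show 0 < ε / (4 * t) by positivity)
  -- The gain `ε` per letter exceeds what `γ` consumes by `ε / 2`. This surplus pays for the `d`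
  -- letters already spent, the Gibbs constants, the distortion `s ^ 2` and `log δ`.
  have hB := eventually_const_add_le
    (f := fun n => 2 * κ' (n + 1) + t * (2 * (R * L n)) + 2 * t * (4 * (R * L n)))
    (by
      have h1 := (tendsto_comp_add_div hκ' 1).const_mul 2
      have h2 := hLdiv.const_mul (t * (2 * R))
      have h3 := hLdiv.const_mul (2 * t * (4 * R))
      have h4 := (h1.add h2).add h3
      simp only [mul_zero, add_zero] at h4
      refine h4.congr fun n => ?_
      ring) (d * x + 2 * β' + t * (2 * β) + 2 * t * α' - Real.log (m.real (cyl 0 w) / 2))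
    (half_pos hε)
  obtain ⟨n, ⟨i', h1, h2, h3⟩, hmass, hA, hB, hn⟩ := (hfreq.and_eventually
    (hmass.and (hA.and (hB.and (eventually_gt_atTop d))))).exists
  refine ⟨n, i', hn, h1, ?_, ?_, hmass⟩
  · have e : ε / (2 * t) = ε / (4 * t) + ε / (4 * t) := by field_simp; ring
    rw [e]
    nlinarith
  · have hκ := ((hLκ (n + 1) (by omega)).trans (hLmono (show n + 1 ≤ n + p i' + 2 by omega))).trans
      h3
    have e1 := mul_le_mul_of_nonneg_left hκ ht.le
    have e2 := mul_le_mul_of_nonneg_left h3 ht.le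
    nlinarith

end MarkovShift

/-! ### Construction of the pattern and its estimates. -/

namespace MarkovShift

variable {I : Type*} {A : I → I → Prop} {μ m : Measure (MarkovShift A)}
  {φ : MarkovShift A → ℝ} {P P' : ℝ} {K K' : ℕ → ℝ} {c c' : I → ℝ}

theorem TopMixing.exists_mem_cyl (hA : TopMixing A) (N : ℕ) (u : MarkovShift A) (i : I) :
    ∃ n, ∃ x ∈ cyl N u, N ≤ n ∧ x n = i := by
  obtain ⟨k, hk⟩ := hA (u N) i
  obtain ⟨y, hy0, hyk⟩ := hk k le_rfl
  obtain ⟨x, hx, hxy⟩ := exists_splice hy0.symm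
  refine ⟨N + k, x, hx, Nat.le_add_right _ _, ?_⟩
  rw [← shift_iterate_apply, hxy, hyk]

theorem cyl_zero_eq {x y : MarkovShift A} (h : x 0 = y 0) : cyl 0 x = cyl 0 y := by
  refine cyl_eq_of_mem fun k hk => ?_
  obtain rfl : k = 0 := by omega
  exact h

theorem IsLocalWeakGibbs.exists_pattern [Countable I] (hA : TopMixing A)
    (h : IsLocalWeakGibbs μ φ P K c) (hφ : Continuous φ) {w : MarkovShift A} {p l : ℕ → ℕ}
    {b : ℝ} (hb : ∀ j, Real.log (c (w (p j))) ≤ b) (N : ℕ) (u : MarkovShift A) {L : ℕ → ℝ}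
    (hL0 : ∀ n, 0 ≤ L n) (hLmono : Monotone L) (hLadd : ∀ a b, L (a + b) ≤ L a + L b)
    (hLK : ∀ n, 1 ≤ n → Real.log (K n) ≤ L n)
    (hLdiv : Tendsto (fun n : ℕ => L n / n) atTop (𝓝 0))
    {t ε sbar : ℝ} (ht : 0 < t) (hε : 0 < ε) (hs0 : 0 ≤ sbar) {R : ℕ}
    (hfreq : ∃ᶠ n : ℕ in atTop, ∃ i, l n ≤ p i ∧
      -Real.log (μ.real (cyl (p i) w)) ≤ (sbar + ε / (4 * t)) * n ∧ L (n + p i + 2) ≤ R * L n)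
    (hm : IsLocalWeakGibbs m (fun x => t * φ x) P' K' c') {b' : ℝ}
    (hb' : ∀ j, Real.log (c' (w (p j))) ≤ b') (hmix : IsMixing m)
    (hΔ : t * sbar + ε ≤ P' - t * P) :
    ∃ (dt d : ℕ → ℕ) (Jt J : ℕ → Set (Set (MarkovShift A))) (J0 : Set (MarkovShift A))
        (δ C : ℝ),
      0 < δ ∧ δ ≤ 1 ∧ 0 < C ∧ IsPattern dt d Jt J J0 ∧ J0 ⊆ cyl N u ∧
      patternSet J ⊆ {z | z ∈ J0 ∧ ∀ j : ℕ, 1 ≤ j → shift^[dt j] z ∈ cyl (l (dt j)) w} ∧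
      {z | z ∈ J0 ∧ ∀ j : ℕ, 1 ≤ j → shift^[dt j] z ∈ cyl (l (dt j)) w} ⊆
        targetSet (cyl N u) l w ∧
      (∀ z ∈ patternSet J, ∀ j, ∃ i, z (d j) = w (p i)) ∧
      PatternEstimates μ m t (fun j => (dt j : ℝ) * (sbar + ε / (2 * t)))
        (fun n => Real.exp (2 * Real.log (c (u 0)) + 2 * b + 4 * L (n + 2))) δ C dt d Jt J ∧
      ENNReal.ofReal t ≤ dimMu μ (patternSet J) := by
  have := h.prob
  have := hm.prob
  -- The root cylinder already ends in a letter `w (p 0)`, so the distortion bounds apply from level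
  -- 0 on.
  obtain ⟨d0, x, hxu, hNd, hxd⟩ := hA.exists_mem_cyl N u (w (p 0))
  obtain ⟨dt, d, idx, hdt0, hd0, hidx, hstep⟩ := exists_times p (exists_next_visit hm.pos hmix
    (g := fun n => -Real.log (μ.real (cyl n w))) (κ := fun n => Real.log (K n))
    (κ' := fun n => Real.log (K' n)) ht hε hfreq hLmono hLK hLdiv hm.log_K_div
    (2 * b + 2 * Real.log (c (w 0)))
    (2 * Real.log (c (u 0)) + 2 * b) b b' (t * sbar + ε)) d0
  have hlt : ∀ j, d j < dt (j + 1) := fun j => (hstep j).1.1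
  have hlp : ∀ j, l (dt (j + 1)) ≤ p (idx (j + 1)) := fun j => (hstep j).1.2.1
  have hq : ∀ j, d (j + 1) = dt (j + 1) + (fun j => p (idx j)) (j + 1) := fun j => (hstep j).2
  set q : ℕ → ℕ := fun j => p (idx j) with hqdef
  set δ : ℝ := m.real (cyl 0 w) / 2 with hδdef
  have hδ : 0 < δ := half_pos (hm.real_pos 0 w)
  have hδ1 : δ ≤ 1 := by
    have : m.real (cyl 0 w) ≤ 1 := measureReal_le_one
    linarith
  set s : ℕ → ℝ := fun n => Real.exp (2 * Real.log (c (u 0)) + 2 * b + 4 * L (n + 2)) with hsdef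
  have hs : IsDistortionSeq μ (u 0) w p s :=
    h.isDistortionSeq hφ hb (u 0) hL0 hLmono hLK hLdiv
  have hpat : IsPattern dt d (visitCylTilde x w dt d q) (visitCyl x w dt d q) (cyl (d 0) x) :=
    isPattern_visitCyl (hdt0.trans hd0.symm) hlt hq
  have hd := hpat.strictMono
  have hmem : ∀ {j : ℕ} {U : Set (MarkovShift A)}, U ∈ visitCyl x w dt d q j → ∀ {z}, z ∈ U →
      z ∈ visitSet x w dt d q j ∧ U = cyl (d j) z :=
    fun hU _ hz => mem_visitSet_of_mem_visitCyl hlt hq hU hz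
  have hend : ∀ j, ∀ z ∈ visitSet x w dt d q j, z 0 = u 0 ∧ z (d j) = w (p (idx j)) := by
    intro j z hz
    refine ⟨(hz.1 0 (Nat.zero_le _)).trans (hxu 0 (Nat.zero_le _)), ?_⟩
    rcases j with _ | j
    · rw [hz.1 (d 0) le_rfl, hd0, hidx, hxd]
    · have h1 := hz.2 j (Nat.lt_succ_self j) (q (j + 1)) le_rfl
      rw [shift_iterate_apply] at h1
      rw [hq j]
      exact h1
  have hstart : ∀ j, ∀ U ∈ visitCyl x w dt d q j, ∀ z ∈ U,
      z 0 = u 0 ∧ ∃ i, z (d j) = w (p i) := fun j U hU z hz =>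
    ⟨(hend j z (hmem hU hz).1).1, _, (hend j z (hmem hU hz).1).2⟩
  have hcmp : ∀ j (z : MarkovShift A), z (d j) = w (p (idx j)) → ∀ r : ℕ,
      Real.log (m.real (cyl r (shift^[d j] z))) - Real.log (m.real (cyl 0 (shift^[d j] z))) ≤
      t * (Real.log (μ.real (cyl r (shift^[d j] z))) -
        Real.log (μ.real (cyl 0 (shift^[d j] z)))) - r * (t * sbar + ε) +
        (2 * b' + 2 * Real.log (K' (r + 1)) + t * (2 * b + 2 * Real.log (K (r + 1)))) := by
    intro j z hz r
    have h1 := h.log_ratio_le hφ ht.le hm r (shift^[d j] z)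
    rw [shift_iterate_apply, Nat.add_zero, hz] at h1
    have h2 := mul_le_mul_of_nonneg_left (hb (idx j)) ht.le
    have h3 := mul_le_mul_of_nonneg_left hΔ (Nat.cast_nonneg (α := ℝ) r)
    linarith [hb' (idx j)]
  have hratio : ∀ {ν : Measure (MarkovShift A)}, (∀ n (x : MarkovShift A), 0 < ν.real (cyl n x)) →
      ∀ {k n : ℕ}, k ≤ n → ∀ z : MarkovShift A, shiftRatio ν k (cyl n z) (cyl k z) =
        Real.exp (Real.log (ν.real (cyl (n - k) (shift^[k] z))) -
          Real.log (ν.real (cyl 0 (shift^[k] z)))) := by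
    intro ν hν k n hkn z
    rw [shiftRatio_cyl ν hkn, div_eq_exp_sub_log (hν _ _) (hν _ _)]
  -- At intermediate depths the gain `ε * r` bounds the Gibbs and distortion errors uniformly. The
  -- constant `C = exp B / δ` makes `C * δ = exp B` and satisfies `C ≥ 1`.
  obtain ⟨B, hB0, hB⟩ := exists_le_of_tendsto_div
    (f := fun r : ℕ => 2 * b' + 2 * Real.log (K' (r + 1)) +
      t * (2 * b + 2 * Real.log (K (r + 1))) + 4 * t * L r) (by
      have h1 := tendsto_const_div_atTop_nhds_zero_nat (2 * b' + t * (2 * b))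
      have h2 := (tendsto_comp_add_div hm.log_K_div 1).const_mul 2
      have h3 := (tendsto_comp_add_div h.log_K_div 1).const_mul (t * 2)
      have h4 := ((h1.add h2).add h3).add (hLdiv.const_mul (4 * t))
      simp only [mul_zero, add_zero] at h4
      refine h4.congr fun n => ?_
      ring) hε
  have hCδ : Real.exp B / δ * δ = Real.exp B := div_mul_cancel₀ _ hδ.ne'
  have hC1 : 1 ≤ Real.exp B / δ := by
    rw [le_div_iff₀ hδ, one_mul]
    exact hδ1.trans (Real.one_le_exp hB0)
  have hδexp : ∀ y, δ * Real.exp y = Real.exp (Real.log δ + y) := fun y => by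
    rw [Real.exp_add, Real.exp_log hδ]
  have hlast : ∀ j, ∀ U ∈ visitCyl x w dt d q j, ∀ z : MarkovShift A, cyl (dt (j + 1)) z ⊆ U →
      shiftRatio m (d j) (cyl (dt (j + 1)) z) U ≤
        δ * (Real.exp (-((dt (j + 1) : ℝ) * (sbar + ε / (2 * t)))) / s (d (j + 1)) ^ 2 *
          shiftRatio μ (d j) (cyl (dt (j + 1)) z) U) ^ t := by
    intro j U hU z hz
    obtain ⟨hzv, rfl⟩ := hmem hU (hz (mem_cyl_self _ _))
    have h1 := hcmp j z (hend j z hzv).2 (dt (j + 1) - d j)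
    have h2 := (hstep j).1.2.2.2.1
    rw [← (hstep j).2] at h2
    have k1 := h.log_K_mono (show dt (j + 1) - d j + 1 ≤ dt (j + 1) + 1 by omega)
    have k2 := hm.log_K_mono (show dt (j + 1) - d j + 1 ≤ dt (j + 1) + 1 by omega)
    have k3 := mul_le_mul_of_nonneg_left k1 ht.le
    rw [hratio hm.real_pos (hlt j).le, hratio h.real_pos (hlt j).le, hsdef, ← Real.exp_nat_mul,
      ← Real.exp_sub, ← Real.exp_add, ← Real.exp_mul]
    rw [hδexp, Real.exp_le_exp]
    rw [Nat.cast_sub (hlt j).le] at h1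
    have e : (dt (j + 1) : ℝ) * (sbar + ε / (2 * t)) * t =
        dt (j + 1) * (t * sbar) + dt (j + 1) * (ε / 2) := by
      field_simp
    simp only at k2 k3
    push_cast
    rw [add_mul, sub_mul, neg_mul, e]
    linarith
  have hest : PatternEstimates μ m t (fun j => (dt j : ℝ) * (sbar + ε / (2 * t))) s δ
      (Real.exp B / δ) dt d (visitCylTilde x w dt d q) (visitCyl x w dt d q) := by
    refine ⟨fun j V hV U hU hUV => ?_, fun j U hU => ?_, fun j U hU z n hn hn' hz => ?_,
      fun j U hU z hz => (hlast j U hU z hz).trans ?_⟩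
    · obtain ⟨z, hz, rfl⟩ := hU
      obtain ⟨v, hv⟩ := hpat.isCyl_tilde _ _ hV
      have hV' : V = cyl (dt (j + 1)) z := by
        rw [hv] at hUV ⊢
        exact (cyl_eq_of_mem (hUV (mem_cyl_self _ _))).symm
      have hzj := hend j z (visitSet_succ_subset j hz)
      have hvis := hz.2 j (Nat.lt_succ_self j)
      have e2 : d (j + 1) - d j = dt (j + 1) - d j + q (j + 1) := by
        have := hq j; have := hlt j; omega
      rw [hV', shiftRatio, shift_image_cyl (hd.monotone (Nat.le_succ j)),
        shift_image_cyl (hlt j).le, div_eq_exp_sub_log (h.real_pos _ _) (h.real_pos _ _),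
        Real.exp_le_exp, e2]
      have h1 := h.log_visit_ratio_ge hφ (dt (j + 1) - d j) (q (j + 1)) (y := shift^[d j] z)
        (w := w) (by rwa [← Function.iterate_add_apply, Nat.sub_add_cancel (hlt j).le])
      rw [shift_iterate_apply, Nat.add_zero (d j), hzj.2] at h1
      have h2 := (hstep j).1.2.2.1
      have h3 := (hLK (dt (j + 1) - d j + q (j + 1) + 1) (by omega)).trans
        (hLmono (show _ ≤ dt (j + 1) + p (idx (j + 1)) + 2 by
          have : q (j + 1) = p (idx (j + 1)) := rfl
          omega))
      have h4 := hb (idx j)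
      linarith
    · obtain ⟨z, hz, rfl⟩ := id hU
      refine le_trans (le_of_eq ?_) (((hstep j).1.2.2.2.2).trans (le_trans (le_of_eq ?_)
        (visit_mass_le (hlt j) rfl fun y hy => (hmem hU hy).1)))
      · rw [shift_image_cyl le_rfl, Nat.sub_self, cyl_zero_eq]
        rw [shift_iterate_apply, shift_iterate_apply, Nat.add_zero, Nat.add_zero, (hend j z hz).2]
      · congr 2
        refine cyl_zero_eq ?_
        rw [shift_iterate_apply, shift_iterate_apply, Nat.add_zero, Nat.add_zero, (hend j z hz).2]
    · obtain ⟨hzv, rfl⟩ := hmem hU (hz (mem_cyl_self _ _))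
      have h1 := hcmp j z (hend j z hzv).2 (n - d j)
      have h2 := hB (n - d j)
      -- Subadditivity of `L` bounds `s n / s (d j)` by `exp (4 * L (n - d j))`, which depends only
      -- on the letters gained since `d j`; this keeps `B` independent of the level.
      have h3 := hLadd (d j + 2) (n - d j)
      rw [show d j + 2 + (n - d j) = n + 2 by omega] at h3
      have h4 := mul_le_mul_of_nonneg_left h3 ht.le
      have h5 : 0 ≤ ((n - d j : ℕ) : ℝ) * (t * sbar) := by positivity
      rw [hratio hm.real_pos hn, hratio h.real_pos hn, hCδ, hsdef, ← Real.exp_sub,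
        ← Real.exp_add, ← Real.exp_mul, ← Real.exp_add, Real.exp_le_exp]
      linarith
    · refine mul_le_mul_of_nonneg_right ?_ (Real.rpow_nonneg ?_ _)
      · exact le_mul_of_one_le_left hδ.le hC1
      · exact mul_nonneg (by positivity) (div_nonneg measureReal_nonneg measureReal_nonneg)
  have hpatmem : ∀ z ∈ patternSet (visitCyl x w dt d q), ∀ j, z ∈ visitSet x w dt d q j := by
    intro z hz j
    obtain ⟨U, hU, hzU⟩ := mem_iInter.1 hz j
    exact (hmem hU hzU).1
  refine ⟨dt, d, _, _, _, δ, Real.exp B / δ, hδ, hδ1, by positivity, hpat, ?_, ?_, ?_, ?_, hest,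
    le_dimMu_patternSet h.real_pos hm.real_pos hs ht hδ hC1 hpat hstart hest hlast⟩
  · exact cyl_subset_of_mem (hd0 ▸ hNd) (mem_cyl_self _ x) hxu
  · intro z hz
    refine ⟨(hpatmem z hz 0).1, fun j hj => ?_⟩
    obtain ⟨k, rfl⟩ := Nat.exists_eq_add_of_le' hj
    exact cyl_anti (hlp k) w ((hpatmem z hz (k + 1)).2 k (Nat.lt_succ_self k))
  · rintro z ⟨hz, hzj⟩
    refine ⟨cyl_subset_of_mem (hd0 ▸ hNd) (mem_cyl_self _ x) hxu hz,
      frequently_atTop.2 fun n => ⟨dt (n + 1), ?_, hzj (n + 1) (by omega)⟩⟩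
    exact hd.le_apply.trans (hlt n).le
  · exact fun z hz j => ⟨_, (hend j z (hpatmem z hz j)).2⟩

end MarkovShift

/-! ### Monotonicity of the dimension, the pressure gap and the main theorem. -/

theorem caratheodoryDim_mono {X : Type*} [MetricSpace X] (F : Set (Set X)) (ψ : Set X → ℝ≥0∞)
    {E E' : Set X} (h : E ⊆ E') : caratheodoryDim F ψ E ≤ caratheodoryDim F ψ E' := by
  refine le_iInf₂ fun α hα =>
    iInf₂_le (f := fun (α : ℝ≥0) (_ : caratheodoryMeasure F (fun B => ψ B ^ (α : ℝ)) E = 0) =>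
      (α : ℝ≥0∞)) α (le_antisymm (le_trans ?_ hα.le) bot_le)
  exact iSup₂_mono fun ε _ => le_iInf₂ fun U hU =>
    iInf₂_le U ⟨hU.1, hU.2.1, h.trans hU.2.2.1, hU.2.2.2⟩

namespace MarkovShift

variable {I : Type*} {A : I → I → Prop} {μ m : Measure (MarkovShift A)}
  {φ : MarkovShift A → ℝ} {P P' : ℝ} {K K' : ℕ → ℝ} {c c' : I → ℝ}

theorem BoundedAlong.exists_log_le (h : IsLocalWeakGibbs μ φ P K c) {w : MarkovShift A}
    {p : ℕ → ℕ} (hw : BoundedAlong c w p) : ∃ b, ∀ j, Real.log (c (w (p j))) ≤ b := by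
  obtain ⟨B, hB⟩ := hw
  exact ⟨Real.log B, fun j => Real.log_le_log (zero_lt_one.trans_le (h.one_le_c _)) (hB ⟨j, rfl⟩)⟩

/-- Only one pressure inequality is needed for each measure: `P'` bounds the pressure of `tφ` from
above, and `P` bounds that of `φ` from below. -/
theorem IsLocalWeakGibbs.le_sub_of_le_pressureGap [Countable I] (h : IsLocalWeakGibbs μ φ P K c)
    (hφ : Continuous φ) (hinv : MeasurePreserving shift μ μ) {t r : ℝ} (ht : 0 < t)
    (hm : IsLocalWeakGibbs m (fun x => t * φ x) P' K' c') (w : MarkovShift A)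
    (hr : (r : EReal) ≤ pressureGap φ t) : r ≤ P' - t * P := by
  have h1 := hm.gurevichPressure_le (continuous_const.mul hφ)
  have h2 := mul_le_mul_of_nonneg_left (h.le_gurevichPressure hφ hinv w)
    (show (0 : EReal) ≤ (t : EReal) by exact_mod_cast ht.le)
  have h3 := hr.trans (EReal.sub_le_sub h1 h2)
  exact_mod_cast h3

theorem IsLocalWeakGibbs.limsup_nonneg (h : IsLocalWeakGibbs μ φ P K c) {w : MarkovShift A}
    {l : ℕ → ℕ} {sbar : ℝ}
    (hsbar : limsup (fun n : ℕ =>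
      ((1 / (n : ℝ) * Real.log (1 / μ.real (cyl (l n) w)) : ℝ) : EReal)) atTop
        = (sbar : EReal)) : 0 ≤ sbar := by
  have := h.prob
  have h0 : (0 : EReal) ≤ (sbar : EReal) := by
    rw [← hsbar, ← limsup_const (f := atTop (α := ℕ)) (0 : EReal)]
    refine limsup_le_limsup (Eventually.of_forall fun n => ?_)
    have : 0 ≤ 1 / (n : ℝ) * Real.log (1 / μ.real (cyl (l n) w)) := by
      refine mul_nonneg (by positivity) (Real.log_nonneg ?_)
      rw [le_div_iff₀ (h.real_pos _ _), one_mul]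
      exact measureReal_le_one
    exact EReal.coe_nonneg.2 this
  exact_mod_cast h0

end MarkovShift

theorem mainTheorem10 {I : Type*} [Countable I] (A : I → I → Prop)
    (hA : MarkovShift.TopMixing A)
    (φ : MarkovShift A → ℝ)
    (hφ : MarkovShift.SummableVariations φ ∨ (Finite I ∧ Continuous φ))
    (μ : Measure (MarkovShift A)) [NullSingletonClass μ]
    (P : ℝ) (K : ℕ → ℝ) (c : I → ℝ)
    (hμ : MarkovShift.IsLocalWeakGibbs μ φ P K c)
    (hinv : MeasurePreserving MarkovShift.shift μ μ)
    (w : MarkovShift A) (p : ℕ → ℕ) (hp : StrictMono p)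
    (hw : MarkovShift.BoundedAlong c w p)
    (l : ℕ → ℕ)
    (hl : ¬ BddAbove (range K) →
      IsBoundedUnder (· ≤ ·) atTop (fun n : ℕ => (l n : ℝ) / (n : ℝ)))
    (N : ℕ) (u : MarkovShift A)
    (sbar : ℝ)
    (hsbar : limsup (fun n : ℕ =>
      ((1 / (n : ℝ) * Real.log (1 / μ.real (MarkovShift.cyl (l n) w)) : ℝ) : EReal)) atTop
        = (sbar : EReal)) :
    (∃ s : ℕ → ℝ, MarkovShift.IsDistortionSeq μ (u 0) w p s ∧
      (BddAbove (range K) → ∀ n, s n = s 0) ∧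
      ∀ (t ε : ℝ) (m : Measure (MarkovShift A)), 0 < t → 0 < ε →
        MarkovShift.pressureGap φ t < ⊤ →
        ((t * sbar + ε : ℝ) : EReal) ≤ MarkovShift.pressureGap φ t →
        MarkovShift.IsAuxMeasure φ w p t m →
        ∃ (dt d : ℕ → ℕ) (Jt J : ℕ → Set (Set (MarkovShift A))) (J0 : Set (MarkovShift A))
          (δ C B : ℝ),
          0 < δ ∧ δ ≤ 1 ∧ 0 < C ∧
          MarkovShift.IsPattern dt d Jt J J0 ∧
          J0 ⊆ MarkovShift.cyl N u ∧
          MarkovShift.patternSet J ⊆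
            {z | z ∈ J0 ∧ ∀ j : ℕ, 1 ≤ j →
              MarkovShift.shift^[dt j] z ∈ MarkovShift.cyl (l (dt j)) w} ∧
          {z | z ∈ J0 ∧ ∀ j : ℕ, 1 ≤ j →
              MarkovShift.shift^[dt j] z ∈ MarkovShift.cyl (l (dt j)) w} ⊆
            MarkovShift.targetSet (MarkovShift.cyl N u) l w ∧
          (∀ z ∈ MarkovShift.patternSet J, ∀ j, c (z (d j)) ≤ B) ∧
          MarkovShift.PatternEstimates μ m t (fun j => (dt j : ℝ) * (sbar + ε / (2 * t))) s δ C
            dt d Jt J ∧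
          ENNReal.ofReal t ≤ MarkovShift.dimMu μ (MarkovShift.patternSet J)) ∧
    sSup {T : ℝ≥0∞ | ∃ t : ℝ, T = ENNReal.ofReal t ∧ 0 < t ∧ t ≤ 1 ∧
        MarkovShift.pressureGap φ t < ⊤ ∧
        ((sbar * t : ℝ) : EReal) < MarkovShift.pressureGap φ t ∧
        ∃ m : Measure (MarkovShift A), MarkovShift.IsAuxMeasure φ w p t m} ≤
      MarkovShift.dimMu μ (MarkovShift.targetSet (MarkovShift.cyl N u) l w) := by
  have hφc : Continuous φ := hφ.elim (fun h => h.continuous) fun h => h.2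
  have hs0 := hμ.limsup_nonneg hsbar
  obtain ⟨b, hb⟩ := hw.exists_log_le hμ
  obtain ⟨L, hL0, hLmono, hLadd, hLK, hLdiv, hLb⟩ :=
    exists_subadditive_majorant hμ.log_K_mono hμ.log_K_nonneg hμ.log_K_div
  have hLb' : BddAbove (range K) → ∀ n, L n = L 0 := by
    rintro ⟨M, hM⟩
    refine hLb ⟨Real.log M, ?_⟩
    rintro _ ⟨n, rfl⟩
    exact Real.log_le_log (zero_lt_one.trans_le (hμ.one_le_K n)) (hM ⟨n, rfl⟩)
  have haux : ∀ (t ε : ℝ) (m : Measure (MarkovShift A)), 0 < t → 0 < ε →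
      ((t * sbar + ε : ℝ) : EReal) ≤ MarkovShift.pressureGap φ t →
      MarkovShift.IsAuxMeasure φ w p t m →
      ∃ (P' : ℝ) (K' : ℕ → ℝ) (c' : I → ℝ) (b' : ℝ) (R : ℕ),
        MarkovShift.IsLocalWeakGibbs m (fun x => t * φ x) P' K' c' ∧
        (∀ j, Real.log (c' (w (p j))) ≤ b') ∧ MarkovShift.IsMixing m ∧
        t * sbar + ε ≤ P' - t * P ∧
        ∃ᶠ n : ℕ in atTop, ∃ i, l n ≤ p i ∧
          -Real.log (μ.real (MarkovShift.cyl (p i) w)) ≤ (sbar + ε / (4 * t)) * n ∧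
          L (n + p i + 2) ≤ R * L n := by
    rintro t ε m ht hε hgap ⟨⟨P', K', c', hm, hw'⟩, -, hmix, -⟩
    obtain ⟨b', hb'⟩ := hw'.exists_log_le hm
    obtain ⟨R, hfreq⟩ := hμ.frequently_hitting hp hl hs0 hsbar hL0 hLmono hLadd hLb'
      (show 0 < ε / (4 * t) by positivity)
    exact ⟨P', K', c', b', R, hm, hb', hmix,
      hμ.le_sub_of_le_pressureGap hφc hinv ht hm w hgap, hfreq⟩
  refine ⟨⟨_, hμ.isDistortionSeq hφc hb (u 0) hL0 hLmono hLK hLdiv, fun hK n => ?_,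
    fun t ε m ht hε _ hgap hm => ?_⟩, sSup_le ?_⟩
  · simp only [hLb' hK]
  · obtain ⟨P', K', c', b', R, hm, hb', hmix, hΔ, hfreq⟩ := haux t ε m ht hε hgap hm
    obtain ⟨dt, d, Jt, J, J0, δ, C, h1, h2, h3, h4, h5, h6, h7, h8, h9, h10⟩ :=
      hμ.exists_pattern hA hφc hb N u hL0 hLmono hLadd hLK hLdiv ht hε hs0 hfreq hm hb' hmix hΔ
    obtain ⟨B, hB⟩ := hw
    refine ⟨dt, d, Jt, J, J0, δ, C, B, h1, h2, h3, h4, h5, h6, h7, fun z hz j => ?_, h9, h10⟩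
    obtain ⟨i, hi⟩ := h8 z hz j
    rw [hi]
    exact hB ⟨i, rfl⟩
  · rintro _ ⟨t, rfl, ht, -, -, hlt, m, hm⟩
    -- A real number strictly between turns the strict inequality into a surplus `ε = r - t * sbar`.
    obtain ⟨r, hr1, hr2⟩ := EReal.lt_iff_exists_real_btwn.1 hlt
    have hr : sbar * t < r := by exact_mod_cast hr1
    have hgap : ((t * sbar + (r - t * sbar) : ℝ) : EReal) ≤ MarkovShift.pressureGap φ t := by
      rw [add_sub_cancel]
      exact hr2.le
    obtain ⟨P', K', c', b', R, hm, hb', hmix, hΔ, hfreq⟩ :=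
      haux t (r - t * sbar) m ht (by linarith) hgap hm
    obtain ⟨dt, d, Jt, J, J0, δ, C, -, -, -, -, -, h6, h7, -, -, h10⟩ :=
      hμ.exists_pattern hA hφc hb N u hL0 hLmono hLadd hLK hLdiv ht (sub_pos.2 (by linarith))
        hs0 hfreq hm hb' hmix hΔ
    exact h10.trans (caratheodoryDim_mono _ _ (h6.trans h7))
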